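/- Let $n\ge1$ and $t\ge0$ be integers. Let $B_n$ be the hyperoctahedral group, i.e. the group of permutations $\pi$ of $[-n,n]\setminus\{0\}$ with $\pi_{-i}=-\pi_i$ for all $i$, regarded as the Coxeter group of type $B_n$ with simple reflections $(1,-1)$ and $(p,p+1)(-p,-(p+1))$ for $1\le p<n$ (cycle notation). Its reflections are the conjugates of the simple reflections, and the (Coxeter) length $\ell(\pi)$ is the least number of simple reflections whose product is $\pi$. Let $\pi^{(t)}=r_1r_2\cdots r_t$, where $r_1,\dots,r_t$ are chosen independently and uniformly at random from the set of reflections of $B_n$. Then the following holds. (a) The expected length of $\pi^{(t)}$ is $$E\bigl[\ell(\pi^{(t)})\bigr]=\frac{n^2}{2}-\frac{n(n+1)}{3}\left(1-\frac{2}{n}\right)^t-\frac{n(n-2)}{6}\left(1-\frac{4}{n}+\frac{2}{n^2}\right)^t.$$ (b) If $i,j\in[-n,n]\setminus\{0\}$ and $j>|i|$, the probability that $\pi^{(t)}_i>\pi^{(t)}_j$ is $$\frac12-\frac{j-i-1+\operatorname{sgn} i}{2(n-1)}\left(1-\frac2n\right)^t+\left(\frac{j-i-1+\operatorname{sgn}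 i}{2(n-1)}-\frac12\right)\left(1-\frac4n+\frac2{n^2}\right)^t.$$ For $1\le i\le n$, the probability that $\pi^{(t)}_{-i}>\pi^{(t)}_i$ is $$\frac12-\frac12\left(1-\frac2n\right)^t.$$ Here $x^0=1$ for every real $x$, including $x=0$. -/

import Mathlib

namespace Hyperoctahedral

/-- The set `[-n, n] \ {0}` of nonzero integers of absolute value at most `n`. -/
abbrev Idx (n : ℕ) : Type := {k : ℤ // k ≠ 0 ∧ |k| ≤ n}

instance (n : ℕ) : Finite (Idx n) :=
  Set.Finite.subset (Set.finite_Icc (-(n : ℤ)) n) fun _ hk => abs_le.mp hk.2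

instance (n : ℕ) : InvolutiveNeg (Idx n) where
  neg k := ⟨-k.1, neg_ne_zero.mpr k.2.1, by rw [abs_neg]; exact k.2.2⟩
  neg_neg k := Subtype.ext (neg_neg k.1)

theorem val_neg {n : ℕ} (k : Idx n) : ((-k : Idx n) : ℤ) = -(k : ℤ) := rfl

/-- The hyperoctahedral group `B_n`: the permutations `π` of `[-n, n] \ {0}` with
`π (-i) = -π i` for all `i`. -/
def SignedPerm (n : ℕ) : Subgroup (Equiv.Perm (Idx n)) where
  carrier := {π | ∀ i, π (-i) = -π i}
  mul_mem' {a b} ha hb i := by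
    rw [Equiv.Perm.mul_apply, Equiv.Perm.mul_apply, hb i, ha]
  one_mem' _ := rfl
  inv_mem' {a} ha i := by
    have h := ha (a⁻¹ i)
    rw [show a (a⁻¹ i) = i from a.apply_symm_apply i] at h
    rw [← h]
    exact a.symm_apply_apply _

/-- The one-line notation of a signed permutation: `entry π i` is `π_i`, as an integer. -/
def entry {n : ℕ} (π : SignedPerm n) (i : Idx n) : ℤ := ((π : Equiv.Perm (Idx n)) i : ℤ)

theorem entry_ext {n : ℕ} {π σ : SignedPerm n} (h : ∀ i, entry π i = entry σ i) : π = σ :=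
  Subtype.ext (Equiv.ext fun i => Subtype.ext (h i))

/-- The positive element `p + 1` of `[-n, n] \ {0}`, for `0 ≤ p < n`. -/
def pos {n : ℕ} (p : ℕ) (hp : p < n) : Idx n :=
  ⟨(p : ℤ) + 1, by omega, by rw [abs_of_nonneg (by omega)]; omega⟩

/-- The underlying permutation of `gen p`. -/
def genPerm {n : ℕ} (p : Fin n) : Equiv.Perm (Idx n) :=
  if h : (p : ℕ) = 0 then
    Equiv.swap (pos p p.2) (-pos p p.2)
  else
    Equiv.swap (pos (p - 1) (by omega)) (pos p p.2) *
      Equiv.swap (-pos (p - 1) (by omega)) (-pos p p.2)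

/-- The action of `gen p` on integers. -/
def act (p : ℕ) (x : ℤ) : ℤ :=
  if p = 0 then (if x = 1 then -1 else if x = -1 then 1 else x)
  else if x = p then p + 1 else if x = p + 1 then p
  else if x = -p then -(p + 1) else if x = -(p + 1) then -p else x

theorem val_swap {n : ℕ} (a b x : Idx n) :
    (Equiv.swap a b x : ℤ) = if (x : ℤ) = a then (b : ℤ) else if (x : ℤ) = b then (a : ℤ) else x := by
  rw [Equiv.swap_apply_def]
  simp only [Subtype.ext_iff]
  split_ifs <;> rfl

theorem genPerm_val {n : ℕ} (p : Fin n) (x : Idx n) : (genPerm p x : ℤ) = act p x := by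
  obtain ⟨p, hp⟩ := p
  unfold genPerm act
  dsimp only
  by_cases h : p = 0
  · rw [dif_pos h, if_pos h, val_swap, val_neg]
    subst h
    simp [pos]
  · have h1 : ((p - 1 : ℕ) : ℤ) + 1 = p := by omega
    rw [dif_neg h, if_neg h, Equiv.Perm.mul_apply, val_swap, val_swap]
    simp only [val_neg, pos, h1]
    generalize (x : ℤ) = y
    split_ifs <;> omega

theorem act_neg (p : ℕ) (x : ℤ) : act p (-x) = -act p x := by
  obtain ⟨y, hy⟩ : ∃ y, y = act p x := ⟨_, rfl⟩
  rw [← hy]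
  unfold act at hy ⊢
  split_ifs at hy ⊢ <;> omega

/-- The standard Coxeter generators of `B_n`: `gen 0` is the transposition `(1, -1)`, and `gen p`
is `(p, p + 1)(-p, -(p + 1))` for `1 ≤ p < n`. -/
def gen {n : ℕ} (p : Fin n) : SignedPerm n :=
  ⟨genPerm p, fun i => Subtype.ext (by
    rw [val_neg, genPerm_val, genPerm_val, val_neg, act_neg])⟩

theorem entry_gen_mul {n : ℕ} (p : Fin n) (π : SignedPerm n) (i : Idx n) :
    entry (gen p * π) i = act p (entry π i) := genPerm_val p _

theorem entry_one {n : ℕ} (i : Idx n) : entry (1 : SignedPerm n) i = i := rfl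

theorem act_act (p : ℕ) (x : ℤ) : act p (act p x) = x := by
  obtain ⟨y, hy⟩ : ∃ y, y = act p x := ⟨_, rfl⟩
  rw [← hy]
  unfold act at hy ⊢
  split_ifs at hy ⊢ <;> omega

theorem act_comm {p q : ℕ} (h : p + 2 ≤ q) (x : ℤ) : act p (act q x) = act q (act p x) := by
  have hp : ∀ r : ℕ, ∀ y : ℤ, (act r y = y ∧ (y < -r - 1 ∨ (-r < y ∧ y < r) ∨ r + 1 < y)) ∨
      ((-r - 1 ≤ y ∧ y ≤ -r ∨ r ≤ y ∧ y ≤ r + 1) ∧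
        (-r - 1 ≤ act r y ∧ act r y ≤ -r ∨ r ≤ act r y ∧ act r y ≤ r + 1)) := by
    intro r y
    unfold act; split_ifs <;> omega
  have fix : ∀ r : ℕ, ∀ y : ℤ, (y < -r - 1 ∨ (-r < y ∧ y < r) ∨ r + 1 < y) → act r y = y := by
    intro r y _
    unfold act; split_ifs <;> omega
  rcases hp q x with ⟨h1, h2⟩ | ⟨h1, h2⟩
  · rw [h1]
    refine (fix q _ ?_).symm
    have := hp p x
    omega
  · rw [fix p x (by omega)]
    exact fix p _ (by omega)

theorem act_braid {p : ℕ} (h : p ≠ 0) (x : ℤ) :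
    act p (act (p + 1) (act p x)) = act (p + 1) (act p (act (p + 1) x)) := by
  have hc : x = p ∨ x = p + 1 ∨ x = p + 2 ∨ x = -p ∨ x = -p - 1 ∨ x = -p - 2 ∨
      (x ≠ p ∧ x ≠ p + 1 ∧ x ≠ p + 2 ∧ x ≠ -p ∧ x ≠ -p - 1 ∧ x ≠ -p - 2) := by omega
  have key : ∀ q : ℕ, q ≠ 0 → ∀ y z : ℤ,
      ((y = q ∧ z = q + 1) ∨ (y = q + 1 ∧ z = q) ∨ (y = -q ∧ z = -q - 1) ∨
      (y = -q - 1 ∧ z = -q) ∨ (y ≠ q ∧ y ≠ q + 1 ∧ y ≠ -q ∧ y ≠ -q - 1 ∧ z = y)) →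
      act q y = z := by
    intro q hq y z hyz
    unfold act; split_ifs <;> omega
  have k1 := key p h
  have k2 := key (p + 1) (by omega)
  push_cast at k2
  rcases hc with rfl | rfl | rfl | rfl | rfl | rfl | hc
  · rw [k1 p (p + 1) (by omega), k2 (p + 1) (p + 2) (by omega), k1 (p + 2) (p + 2) (by omega),
      k2 p p (by omega), k1 p (p + 1) (by omega), k2 (p + 1) (p + 2) (by omega)]
  · rw [k1 (p + 1) p (by omega), k2 p p (by omega), k1 p (p + 1) (by omega),
      k2 (p + 1) (p + 2) (by omega), k1 (p + 2) (p + 2) (by omega), k2 (p + 2) (p + 1) (by omega)]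
  · rw [k1 (p + 2) (p + 2) (by omega), k2 (p + 2) (p + 1) (by omega), k1 (p + 1) p (by omega),
      k2 p p (by omega)]
  · rw [k1 (-p) (-p - 1) (by omega), k2 (-p - 1) (-p - 2) (by omega),
      k1 (-p - 2) (-p - 2) (by omega), k2 (-p) (-p) (by omega), k1 (-p) (-p - 1) (by omega),
      k2 (-p - 1) (-p - 2) (by omega)]
  · rw [k1 (-p - 1) (-p) (by omega), k2 (-p) (-p) (by omega), k1 (-p) (-p - 1) (by omega),
      k2 (-p - 1) (-p - 2) (by omega), k1 (-p - 2) (-p - 2) (by omega),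
      k2 (-p - 2) (-p - 1) (by omega)]
  · rw [k1 (-p - 2) (-p - 2) (by omega), k2 (-p - 2) (-p - 1) (by omega),
      k1 (-p - 1) (-p) (by omega), k2 (-p) (-p) (by omega)]
  · rw [k1 x x (by omega), k2 x x (by omega), k1 x x (by omega), k2 x x (by omega)]

theorem act_four (x : ℤ) : act 0 (act 1 (act 0 (act 1 x))) = act 1 (act 0 (act 1 (act 0 x))) := by
  have hc : x = 1 ∨ x = 2 ∨ x = -1 ∨ x = -2 ∨ (x ≠ 1 ∧ x ≠ 2 ∧ x ≠ -1 ∧ x ≠ -2) := by omega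
  rcases hc with rfl | rfl | rfl | rfl | ⟨a, b, c, d⟩
  · rfl
  · rfl
  · rfl
  · rfl
  · have h0 : act 0 x = x := by unfold act; split_ifs <;> omega
    have h1 : act 1 x = x := by unfold act; split_ifs <;> omega
    simp only [h0, h1]

section Abstract

variable {G : Type*} [Group G] (s : ℕ → G) (n : ℕ)

/-- The relations of type `B_n` for `s 0, …, s (n - 1)`, in braid form. -/
structure Rel : Prop where
  sq : ∀ p < n, s p * s p = 1
  comm : ∀ p q, p + 2 ≤ q → q < n → s p * s q = s q * s p
  braid : ∀ p, p ≠ 0 → p + 1 < n → s p * s (p + 1) * s p = s (p + 1) * s p * s (p + 1)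
  four : 1 < n → s 0 * s 1 * s 0 * s 1 = s 1 * s 0 * s 1 * s 0

/-- Coset representatives: the right segments of `s k ⋯ s 1 s 0 s 1 ⋯ s k`. -/
def rep (k : ℕ) : ℕ → G
  | 0 => 1
  | m + 1 => s (if m ≤ k then k - m else m - k) * rep k m

variable {s n}

theorem rep_succ_le {k m : ℕ} (h : m ≤ k) : rep s k (m + 1) = s (k - m) * rep s k m := by
  rw [rep, if_pos h]

theorem rep_succ_gt {k r : ℕ} : rep s k (k + 1 + r + 1) = s (r + 1) * rep s k (k + 1 + r) := by
  rw [rep, if_neg (by omega)]; congr 2; omega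

theorem rep_one (hs : Rel s n) {k : ℕ} (hk : k < n) {i : ℕ} :
    ∀ m, i + m < k + 0 → s i * rep s k m = rep s k m * s i := by
  intro m
  induction m with
  | zero => intro _; simp [rep]
  | succ m ih =>
    intro h
    rw [rep_succ_le (by omega), ← mul_assoc, hs.comm i (k - m) (by omega) (by omega), mul_assoc,
      ih (by omega), mul_assoc]

theorem rep_two (hs : Rel s n) {k : ℕ} (hk : k < n) {i : ℕ} (hi : 2 ≤ i) (hik : i ≤ k) :
    ∀ m, m ≤ k + 1 → k + 2 ≤ i + m → s i * rep s k m = rep s k m * s (i - 1) := by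
  intro m
  induction m with
  | zero => intro _ _; omega
  | succ m ih =>
    intro h1 h2
    rw [rep_succ_le (by omega)]
    by_cases h : k - m + 2 ≤ i
    · rw [← mul_assoc, ← hs.comm (k - m) i h (by omega), mul_assoc, ih (by omega) (by omega),
        mul_assoc]
    · obtain ⟨m, rfl⟩ : ∃ m', m = m' + 1 := ⟨m - 1, by omega⟩
      obtain ⟨j, rfl⟩ : ∃ j, i = j + 1 := ⟨i - 1, by omega⟩
      have e1 : k - (m + 1) = j := by omega
      have e2 : k - m = j + 1 := by omega
      rw [rep_succ_le (by omega), e1, e2, ← mul_assoc, ← mul_assoc,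
        ← hs.braid j (by omega) (by omega), mul_assoc, rep_one hs hk m (by omega)]
      simp [mul_assoc]

theorem rep_three (hs : Rel s n) {k : ℕ} (hk : k < n) {i : ℕ} (hi : 2 ≤ i) (hik : i ≤ k) :
    ∀ r, r + 1 < i → s i * rep s k (k + 1 + r) = rep s k (k + 1 + r) * s (i - 1) := by
  intro r
  induction r with
  | zero => intro _; exact rep_two hs hk hi hik _ (by omega) (by omega)
  | succ r ih =>
    intro h
    rw [← add_assoc, rep_succ_gt, ← mul_assoc, ← hs.comm (r + 1) i (by omega) (by omega),
      mul_assoc, ih (by omega), mul_assoc]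

theorem rep_four (hs : Rel s n) {k : ℕ} (hk : k < n) {i : ℕ} :
    ∀ r, i < r → r ≤ k → s i * rep s k (k + 1 + r) = rep s k (k + 1 + r) * s i := by
  intro r
  induction r with
  | zero => intro h; omega
  | succ r ih =>
    intro h hr
    rw [← add_assoc, rep_succ_gt]
    by_cases hir : i < r
    · rw [← mul_assoc, hs.comm i (r + 1) (by omega) (by omega), mul_assoc, ih hir (by omega),
        mul_assoc]
    · obtain rfl : i = r := by omega
      rcases i with _ | i
      · obtain ⟨k, rfl⟩ : ∃ k', k = k' + 1 := ⟨k - 1, by omega⟩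
        have e : s 0 * rep s (k + 1) k = rep s (k + 1) k * s 0 := rep_one hs hk k (by omega)
        have e1 : k + 1 - (k + 1) = 0 := by omega
        have e2 : k + 1 - k = 1 := by omega
        rw [add_zero, rep_succ_le le_rfl, rep_succ_le (by omega), e1, e2]
        have h4 := hs.four (by omega)
        calc s 0 * (s (0 + 1) * (s 0 * (s 1 * rep s (k + 1) k)))
            = (s 0 * s 1 * s 0 * s 1) * rep s (k + 1) k := by simp [mul_assoc]
          _ = s 1 * s 0 * s 1 * (s 0 * rep s (k + 1) k) := by rw [h4]; simp [mul_assoc]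
          _ = _ := by rw [e]; simp [mul_assoc]
      · have e := rep_three hs hk (i := i + 2) (by omega) (by omega) i (by omega)
        have e0 : i + 2 - 1 = i + 1 := by omega
        rw [e0] at e
        rw [← add_assoc, rep_succ_gt, ← mul_assoc, ← mul_assoc,
          hs.braid (i + 1) (by omega) (by omega), mul_assoc, e]
        simp [mul_assoc]

variable (s) in
/-- The subgroup generated by `s 0, …, s (k - 1)`. -/
def para (k : ℕ) : Subgroup G := Subgroup.closure {g | ∃ p < k, g = s p}

theorem mem_para {p k : ℕ} (h : p < k) : s p ∈ para s k := Subgroup.subset_closure ⟨p, h, rfl⟩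

theorem para_mono {k l : ℕ} (h : k ≤ l) : para s k ≤ para s l :=
  Subgroup.closure_mono fun _ ⟨p, hp, e⟩ => ⟨p, by omega, e⟩

theorem mul_rep (hs : Rel s n) {k : ℕ} (hk : k < n) {i m : ℕ} (hi : i ≤ k) (hm : m ≤ 2 * k + 1) :
    ∃ m' ≤ 2 * k + 1, ∃ h ∈ para s k, s i * rep s k m = rep s k m' * h := by
  have cancel : ∀ x : G, s i * (s i * x) = x := fun x => by
    rw [← mul_assoc, hs.sq i (by omega), one_mul]
  by_cases hmk : m ≤ k
  · rcases lt_trichotomy i (k - m) with h | h | h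
    · exact ⟨m, hm, s i, mem_para (by omega), rep_one hs hk m (by omega)⟩
    · exact ⟨m + 1, by omega, 1, one_mem _, by rw [rep_succ_le hmk, h, mul_one]⟩
    · obtain ⟨m, rfl⟩ : ∃ m', m = m' + 1 := ⟨m - 1, by omega⟩
      by_cases h' : i = k - m
      · exact ⟨m, by omega, 1, one_mem _, by
          rw [rep_succ_le (by omega), ← h', cancel, mul_one]⟩
      · exact ⟨m + 1, hm, s (i - 1), mem_para (by omega),
          rep_two hs hk (by omega) hi _ (by omega) (by omega)⟩
  · obtain ⟨r, rfl⟩ : ∃ r, m = k + 1 + r := ⟨m - k - 1, by omega⟩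
    rcases lt_trichotomy i r with h | h | h
    · exact ⟨_, hm, s i, mem_para (by omega), rep_four hs hk r h (by omega)⟩
    · refine ⟨k + r, by omega, 1, one_mem _, ?_⟩
      rw [mul_one]
      rcases r with _ | r
      · rw [add_zero, rep_succ_le le_rfl, Nat.sub_self, ← h, cancel, h, add_zero]
      · rw [← add_assoc, rep_succ_gt, ← h, cancel]
        congr 1; omega
    · by_cases h' : i = r + 1
      · exact ⟨k + 1 + r + 1, by omega, 1, one_mem _, by rw [rep_succ_gt, h', mul_one]⟩
      · exact ⟨_, hm, s (i - 1), mem_para (by omega),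
          rep_three hs hk (by omega) hi r (by omega)⟩

theorem rep_mem {k : ℕ} : ∀ m ≤ 2 * k + 1, rep s k m ∈ para s (k + 1) := by
  intro m
  induction m with
  | zero => intro _; exact one_mem _
  | succ m ih =>
    intro h
    exact mul_mem (mem_para (by split_ifs <;> omega)) (ih (by omega))

theorem exists_rep (hs : Rel s n) {k : ℕ} (hk : k < n) {g : G} (hg : g ∈ para s (k + 1)) :
    ∃ m ≤ 2 * k + 1, ∃ h ∈ para s k, g = rep s k m * h := by
  have step : ∀ p < k + 1, ∀ y : G, (∃ m ≤ 2 * k + 1, ∃ h ∈ para s k, y = rep s k m * h) →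
      ∃ m ≤ 2 * k + 1, ∃ h ∈ para s k, s p * y = rep s k m * h := by
    rintro p hp y ⟨m, hm, h, hh, rfl⟩
    obtain ⟨m', hm', h', hh', e⟩ := mul_rep hs hk (i := p) (by omega) hm
    exact ⟨m', hm', h' * h, mul_mem hh' hh, by rw [← mul_assoc, e, mul_assoc]⟩
  induction hg using Subgroup.closure_induction_left with
  | one => exact ⟨0, by omega, 1, one_mem _, by simp [rep]⟩
  | mul_left x hx y _ ih =>
    obtain ⟨p, hp, rfl⟩ := hx
    exact step p hp y ih
  | inv_mul_cancel x hx y _ ih =>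
    obtain ⟨p, hp, rfl⟩ := hx
    rw [inv_eq_of_mul_eq_one_left (hs.sq p (by omega))]
    exact step p hp y ih

end Abstract

theorem gen_sq {n : ℕ} (p : Fin n) : gen p * gen p = 1 := by
  refine entry_ext fun i => ?_
  rw [← mul_one (gen p), mul_assoc, entry_gen_mul, one_mul, entry_gen_mul, act_act]

theorem gen_comm {n : ℕ} {p q : Fin n} (h : (p : ℕ) + 2 ≤ q) : gen p * gen q = gen q * gen p := by
  refine entry_ext fun i => ?_
  rw [← mul_one (gen p), ← mul_one (gen q)]
  simp only [mul_assoc, one_mul, entry_gen_mul, act_comm h]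

theorem gen_braid {n : ℕ} {p q : Fin n} (h : (p : ℕ) ≠ 0) (hq : (q : ℕ) = p + 1) :
    gen p * gen q * gen p = gen q * gen p * gen q := by
  refine entry_ext fun i => ?_
  rw [← mul_one (gen p), ← mul_one (gen q)]
  simp only [mul_assoc, one_mul, entry_gen_mul, hq, act_braid h]

theorem gen_four {n : ℕ} {p q : Fin n} (h : (p : ℕ) = 0) (hq : (q : ℕ) = 1) :
    gen p * gen q * gen p * gen q = gen q * gen p * gen q * gen p := by
  refine entry_ext fun i => ?_
  rw [← mul_one (gen p), ← mul_one (gen q)]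
  simp only [mul_assoc, one_mul, entry_gen_mul, hq, h, act_four]

theorem isLiftable (n : ℕ) :
    (CoxeterMatrix.B n).IsLiftable (fun k : Fin n => gen k.rev) := by
  have hB : ∀ i j : Fin n, (CoxeterMatrix.B n) i j = if i = j then 1
      else (if (i : ℕ) = n - 1 ∧ (j : ℕ) = n - 2 ∨ (j : ℕ) = n - 1 ∧ (i : ℕ) = n - 2 then 4
        else (if (j : ℕ) + 1 = i ∨ (i : ℕ) + 1 = j then 3 else 2)) := fun _ _ => rfl
  have inv3 : ∀ a b : SignedPerm n, a * a = 1 → b * b = 1 → a * b * a = b * a * b →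
      (a * b) ^ 3 = 1 := by
    intro a b ha hb h
    calc (a * b) ^ 3 = (a * b * a) * (b * a * b) := by simp [pow_succ, mul_assoc]
      _ = (b * a) * (b * b) * (a * b) := by rw [h]; simp [mul_assoc]
      _ = b * (a * a) * b := by rw [hb]; simp [mul_assoc]
      _ = 1 := by rw [ha, mul_one, hb]
  have inv4 : ∀ a b : SignedPerm n, a * a = 1 → b * b = 1 → a * b * a * b = b * a * b * a →
      (a * b) ^ 4 = 1 := by
    intro a b ha hb h
    calc (a * b) ^ 4 = (a * b * a * b) * (a * b * a * b) := by simp [pow_succ, mul_assoc]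
      _ = (b * a * b) * (a * a) * (b * a * b) := by nth_rewrite 1 [h]; simp [mul_assoc]
      _ = (b * a) * (b * b) * (a * b) := by rw [ha]; simp [mul_assoc]
      _ = b * (a * a) * b := by rw [hb]; simp [mul_assoc]
      _ = 1 := by rw [ha, mul_one, hb]
  have inv2 : ∀ a b : SignedPerm n, a * a = 1 → b * b = 1 → a * b = b * a →
      (a * b) ^ 2 = 1 := by
    intro a b ha hb h
    calc (a * b) ^ 2 = (a * b) * (a * b) := by simp [pow_succ]
      _ = b * (a * a) * b := by nth_rewrite 1 [h]; simp [mul_assoc]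
      _ = 1 := by rw [ha, mul_one, hb]
  intro i j
  have hi := i.2
  have hj := j.2
  have vi : ((i.rev : Fin n) : ℕ) = n - (i + 1) := Fin.val_rev i
  have vj : ((j.rev : Fin n) : ℕ) = n - (j + 1) := Fin.val_rev j
  rw [hB]
  split_ifs with h1 h2 h3
  · rw [h1, gen_sq, one_pow]
  · have h1' : (i : ℕ) ≠ j := fun e => h1 (Fin.ext e)
    refine inv4 _ _ (gen_sq _) (gen_sq _) ?_
    rcases h2 with h2 | h2
    · exact gen_four (by omega) (by omega)
    · exact (gen_four (by omega) (by omega)).symm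
  · have h1' : (i : ℕ) ≠ j := fun e => h1 (Fin.ext e)
    refine inv3 _ _ (gen_sq _) (gen_sq _) ?_
    rcases h3 with h3 | h3
    · exact gen_braid (by omega) (by omega)
    · exact (gen_braid (by omega) (by omega)).symm
  · have h1' : (i : ℕ) ≠ j := fun e => h1 (Fin.ext e)
    refine inv2 _ _ (gen_sq _) (gen_sq _) ?_
    rcases lt_or_gt_of_ne h1' with h | h
    · exact (gen_comm (by omega)).symm
    · exact gen_comm (by omega)

/-- The canonical map from the abstract Coxeter group of type `B_n` to signed permutations. -/
noncomputable def toSigned (n : ℕ) : (CoxeterMatrix.B n).Group →* SignedPerm n :=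
  (CoxeterMatrix.B n).toCoxeterSystem.lift ⟨fun k : Fin n => gen k.rev, isLiftable n⟩

theorem toSigned_simple {n : ℕ} (k : Fin n) :
    toSigned n ((CoxeterMatrix.B n).simple k) = gen k.rev :=
  (CoxeterMatrix.B n).toCoxeterSystem.lift_apply_simple (isLiftable n) k

/-- The simple reflections of the abstract Coxeter group of type `B_n`, in the order of `gen`. -/
noncomputable def absGen (n p : ℕ) : (CoxeterMatrix.B n).Group :=
  if h : p < n then (CoxeterMatrix.B n).simple (Fin.rev ⟨p, h⟩) else 1

theorem absGen_rel (n : ℕ) : Rel (absGen n) n := by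
  have hB : ∀ i j : Fin n, (CoxeterMatrix.B n) i j = if i = j then 1
      else (if (i : ℕ) = n - 1 ∧ (j : ℕ) = n - 2 ∨ (j : ℕ) = n - 1 ∧ (i : ℕ) = n - 2 then 4
        else (if (j : ℕ) + 1 = i ∨ (i : ℕ) + 1 = j then 3 else 2)) := fun _ _ => rfl
  have hr : ∀ i j : Fin n, ((CoxeterMatrix.B n).simple i * (CoxeterMatrix.B n).simple j) ^
      (CoxeterMatrix.B n) i j = 1 :=
    (CoxeterMatrix.B n).toCoxeterSystem.simple_mul_simple_pow
  have sq : ∀ p < n, absGen n p * absGen n p = 1 := by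
    intro p hp
    simp only [absGen, dif_pos hp]
    exact (CoxeterMatrix.B n).toCoxeterSystem.simple_mul_simple_self _
  have inv : ∀ p < n, (absGen n p)⁻¹ = absGen n p := fun p hp =>
    inv_eq_of_mul_eq_one_left (sq p hp)
  refine ⟨sq, ?_, ?_, ?_⟩
  · intro p q hpq hq
    have h := hr (Fin.rev ⟨p, by omega⟩) (Fin.rev ⟨q, hq⟩)
    rw [hB, if_neg (by rw [Fin.ext_iff, Fin.val_rev, Fin.val_rev]; dsimp only; omega),
      if_neg (by rw [Fin.val_rev, Fin.val_rev]; dsimp only; omega),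
      if_neg (by rw [Fin.val_rev, Fin.val_rev]; dsimp only; omega)] at h
    have h' : (absGen n p * absGen n q) ^ 2 = 1 := by
      simp only [absGen, dif_pos hq, dif_pos (show p < n by omega)]; exact h
    rw [pow_two] at h'
    rw [eq_inv_of_mul_eq_one_left h', mul_inv_rev, inv p (by omega), inv q hq]
  · intro p hp hq
    have h := hr (Fin.rev ⟨p, by omega⟩) (Fin.rev ⟨p + 1, hq⟩)
    rw [hB, if_neg (by rw [Fin.ext_iff, Fin.val_rev, Fin.val_rev]; dsimp only; omega),
      if_neg (by rw [Fin.val_rev, Fin.val_rev]; dsimp only; omega),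
      if_pos (by rw [Fin.val_rev, Fin.val_rev]; dsimp only; omega)] at h
    have h' : (absGen n p * absGen n (p + 1)) ^ 3 = 1 := by
      simp only [absGen, dif_pos hq, dif_pos (show p < n by omega)]; exact h
    have h2 : (absGen n p * absGen n (p + 1) * absGen n p) *
        (absGen n (p + 1) * absGen n p * absGen n (p + 1)) = 1 := by
      rw [← h']; simp only [pow_succ, pow_zero, one_mul, mul_assoc]
    rw [eq_inv_of_mul_eq_one_left h2, mul_inv_rev, mul_inv_rev, inv p (by omega), inv _ hq,
      mul_assoc]
  · intro hn
    have h := hr (Fin.rev ⟨0, by omega⟩) (Fin.rev ⟨1, hn⟩)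
    rw [hB, if_neg (by rw [Fin.ext_iff, Fin.val_rev, Fin.val_rev]; dsimp only; omega),
      if_pos (by rw [Fin.val_rev, Fin.val_rev]; dsimp only; omega)] at h
    have h' : (absGen n 0 * absGen n 1) ^ 4 = 1 := by
      simp only [absGen, dif_pos hn, dif_pos (show 0 < n by omega)]; exact h
    have h2 : (absGen n 0 * absGen n 1 * absGen n 0 * absGen n 1) *
        (absGen n 0 * absGen n 1 * absGen n 0 * absGen n 1) = 1 := by
      rw [← h']; simp only [pow_succ, pow_zero, one_mul, mul_assoc]
    rw [eq_inv_of_mul_eq_one_left h2]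
    simp only [mul_inv_rev, inv 0 (show 0 < n by omega), inv 1 hn, mul_assoc]

theorem entry_absGen_mul {n p : ℕ} (hp : p < n) (g : (CoxeterMatrix.B n).Group) (i : Idx n) :
    entry (toSigned n (absGen n p * g)) i = act p (entry (toSigned n g) i) := by
  rw [map_mul, absGen, dif_pos hp, toSigned_simple, Fin.rev_rev, entry_gen_mul]

/-- The image of `k + 1` under the `m`-th coset representative. -/
theorem entry_rep {n k : ℕ} (hk : k < n) : ∀ m ≤ 2 * k + 1,
    entry (toSigned n (rep (absGen n) k m)) (pos k hk) =
      if m ≤ k then (k : ℤ) + 1 - m else (k : ℤ) - m := by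
  intro m
  induction m with
  | zero => intro _; simp [rep, entry_one, pos]
  | succ m ih =>
    intro h
    rw [rep, entry_absGen_mul (by split_ifs <;> omega), ih (by omega)]
    unfold act
    push_cast
    split_ifs <;> omega

theorem entry_para {n k : ℕ} (hk : k ≤ n) {g : (CoxeterMatrix.B n).Group}
    (hg : g ∈ para (absGen n) k) (i : Idx n) (hi : (k : ℤ) < |(i : ℤ)|) :
    entry (toSigned n g) i = i := by
  have fix : ∀ p < k, act p (i : ℤ) = i := by
    intro p hp
    rcases abs_cases (i : ℤ) with ⟨h, _⟩ | ⟨h, _⟩ <;> rw [h] at hi <;> unfold act <;>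
      split_ifs <;> omega
  induction hg using Subgroup.closure_induction_left with
  | one => rw [map_one, entry_one]
  | mul_left x hx y _ ih =>
    obtain ⟨p, hp, rfl⟩ := hx
    rw [entry_absGen_mul (by omega), ih, fix p hp]
  | inv_mul_cancel x hx y _ ih =>
    obtain ⟨p, hp, rfl⟩ := hx
    rw [inv_eq_of_mul_eq_one_left ((absGen_rel n).sq p (by omega)), entry_absGen_mul (by omega),
      ih, fix p hp]

theorem para_eq_one {n : ℕ} : ∀ k ≤ n, ∀ g ∈ para (absGen n) k, toSigned n g = 1 → g = 1 := by
  intro k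
  induction k with
  | zero =>
    intro _ g hg _
    have h : para (absGen n) 0 = ⊥ := by
      rw [para, Subgroup.closure_eq_bot_iff]
      rintro x ⟨p, hp, -⟩
      omega
    rwa [h, Subgroup.mem_bot] at hg
  | succ k ih =>
    intro hk g hg h1
    obtain ⟨m, hm, h, hh, rfl⟩ := exists_rep (absGen_rel n) (by omega : k < n) hg
    have hv : (pos k (show k < n by omega) : Idx n).1 = (k : ℤ) + 1 := rfl
    have e1 : (toSigned n h : Equiv.Perm (Idx n)) (pos k (by omega)) = pos k (by omega) :=
      Subtype.ext (entry_para (show k ≤ n by omega) hh _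
        ((show (k : ℤ) < (k : ℤ) + 1 by omega).trans_le (hv ▸ le_abs_self _)))
    have e2 : entry (toSigned n (rep (absGen n) k m * h)) (pos k (by omega)) =
        entry (toSigned n (rep (absGen n) k m)) (pos k (by omega)) := by
      rw [map_mul]
      exact congrArg (fun x => (((toSigned n (rep (absGen n) k m) : SignedPerm n) :
        Equiv.Perm (Idx n)) x : ℤ)) e1
    rw [entry_rep (show k < n by omega) m hm, h1, entry_one, hv] at e2
    have hm0 : m = 0 := by split_ifs at e2 <;> omega
    subst hm0
    have er : rep (absGen n) k 0 * h = h := by rw [rep, one_mul]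
    rw [er] at h1 ⊢
    exact ih (by omega) h hh h1

theorem exists_para {n : ℕ} : ∀ k ≤ n, ∀ w : SignedPerm n,
    (∀ i : Idx n, (k : ℤ) < |(i : ℤ)| → entry w i = i) →
      ∃ g ∈ para (absGen n) k, toSigned n g = w := by
  intro k
  induction k with
  | zero =>
    intro _ w hw
    refine ⟨1, one_mem _, ?_⟩
    rw [map_one]
    exact entry_ext fun i => (hw i (by exact_mod_cast abs_pos.mpr i.2.1)).symm
  | succ k ih =>
    intro hk w hw
    have hkn : k < n := by omega
    obtain ⟨a, ha⟩ : ∃ a, a = (w : Equiv.Perm (Idx n)) (pos k hkn) := ⟨_, rfl⟩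
    have hak : |(a : ℤ)| ≤ k + 1 := by
      by_contra! hc
      have h1 : (w : Equiv.Perm (Idx n)) a = a := Subtype.ext (hw a (by push_cast; exact hc))
      have h2 : a = pos k hkn := w.1.injective (h1.trans ha)
      rw [h2] at hc
      have h3 : |((pos k hkn : Idx n) : ℤ)| = k + 1 := abs_of_nonneg (by simp only [pos]; omega)
      omega
    have ha0 := a.2.1
    obtain ⟨hl, hu⟩ := abs_le.mp hak
    obtain ⟨m, hm, hma⟩ : ∃ m ≤ 2 * k + 1,
        entry (toSigned n (rep (absGen n) k m)) (pos k hkn) = (a : ℤ) := by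
      by_cases hpos : 0 < (a : ℤ)
      · refine ⟨(k + 1 - (a : ℤ)).toNat, by omega, ?_⟩
        rw [entry_rep hkn _ (by omega)]
        split_ifs <;> omega
      · refine ⟨(k - (a : ℤ)).toNat, by omega, ?_⟩
        rw [entry_rep hkn _ (by omega)]
        split_ifs <;> omega
    set r := rep (absGen n) k m with hr
    have hrm : r ∈ para (absGen n) (k + 1) := rep_mem m hm
    obtain ⟨h, hh, hw'⟩ := ih (by omega) ((toSigned n r)⁻¹ * w) (by
      intro i hi
      have key : (w : Equiv.Perm (Idx n)) i = (toSigned n r : Equiv.Perm (Idx n)) i := by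
        by_cases hi' : ((k + 1 : ℕ) : ℤ) < |(i : ℤ)|
        · exact Subtype.ext ((hw i hi').trans (entry_para (by omega) hrm i hi').symm)
        · have hp : (w : Equiv.Perm (Idx n)) (pos k hkn) =
              (toSigned n r : Equiv.Perm (Idx n)) (pos k hkn) :=
            ha.symm.trans (Subtype.ext hma).symm
          have hi2 : |(i : ℤ)| = k + 1 := by push_cast at hi'; omega
          rcases (abs_eq (by omega)).mp hi2 with h | h
          · have : i = pos k hkn := Subtype.ext h
            rw [this, hp]
          · have : i = -pos k hkn := Subtype.ext h
            rw [this, w.2, (toSigned n r).2, hp]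
      have e : (((toSigned n r)⁻¹ * w : SignedPerm n) : Equiv.Perm (Idx n)) i = i := by
        change (toSigned n r : Equiv.Perm (Idx n)).symm ((w : Equiv.Perm (Idx n)) i) = i
        rw [key, Equiv.symm_apply_apply]
      exact congrArg Subtype.val e)
    exact ⟨r * h, mul_mem hrm (para_mono (by omega) hh), by rw [map_mul, hw', mul_inv_cancel_left]⟩

theorem para_eq_top (n : ℕ) : para (absGen n) n = ⊤ := by
  rw [← top_le_iff, ← (CoxeterMatrix.B n).toCoxeterSystem.subgroup_closure_range_simple,
    Subgroup.closure_le]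
  rintro _ ⟨i, rfl⟩
  refine Subgroup.subset_closure ⟨(i.rev : Fin n), i.rev.2, ?_⟩
  rw [absGen, dif_pos i.rev.2, Fin.eta, Fin.rev_rev]
  rfl

theorem toSigned_bijective (n : ℕ) : Function.Bijective (toSigned n) := by
  refine ⟨(injective_iff_map_eq_one _).mpr fun g hg => para_eq_one n le_rfl g
    (by rw [para_eq_top]; trivial) hg, fun w => ?_⟩
  obtain ⟨g, -, hg⟩ := exists_para n le_rfl w fun i hi => absurd i.2.2 (not_le.mpr hi)
  exact ⟨g, hg⟩

/-- The signed permutations form a Coxeter system of type `B_n`, with simple reflections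
`(1, -1)` and `(p, p + 1)(-p, -(p + 1))`, `1 ≤ p < n`. In `CoxeterMatrix.B n` the node of the
double bond is the last one, so that the node `k` corresponds to `gen (n - 1 - k)`. -/
noncomputable def coxeterSystem (n : ℕ) : CoxeterSystem (CoxeterMatrix.B n) (SignedPerm n) :=
  ⟨(MulEquiv.ofBijective (toSigned n) (toSigned_bijective n)).symm⟩

theorem coxeterSystem_simple {n : ℕ} (k : Fin n) : (coxeterSystem n).simple k = gen k.rev :=
  toSigned_simple k

/-- The set `T` of reflections of `B_n`: the conjugates of the simple reflections. -/
noncomputable def reflections (n : ℕ) : Finset (SignedPerm n) :=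
  (Set.toFinite {w | (coxeterSystem n).IsReflection w}).toFinset

/-- The expected value `E_{R,φ}(t) = |R|^(-t) ∑ φ (r_1 ⋯ r_t)` (sum over all
`r_1, …, r_t ∈ R`) of `φ` at a product of `t` random elements, chosen independently and
uniformly from `R`. -/
noncomputable def expected {M : Type*} [Monoid M] (R : Finset M) (φ : M → ℕ) (t : ℕ) : ℝ :=
  (∑ r : Fin t → R, (φ (List.ofFn fun k => (r k : M)).prod : ℝ)) / (R.card : ℝ) ^ t

open Classical in
/-- The probability that a product of `t` random elements, chosen independently and uniformly
from `R`, satisfies `P`. -/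
noncomputable def prob {M : Type*} [Monoid M] (R : Finset M) (P : M → Prop) (t : ℕ) : ℝ :=
  ((Finset.univ.filter fun r : Fin t → R => P (List.ofFn fun k => (r k : M)).prod).card : ℝ) /
    (R.card : ℝ) ^ t

end Hyperoctahedral

namespace Hyperoctahedral

variable {n : ℕ}

/-! The random walk is analysed through eigenfunctions. If summing `f (y * x)` over all reflections
`y` multiplies `f x` by `R.card * c`, then the mean of `f` after `t` steps is `c ^ t * f 1`
(`avg_eigen`). It therefore suffices to write the indicator of an inversion as a combination of such
functions.

Two families are enough. An odd function of a single entry has eigenvalue `n ^ 2 - 2 * n`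
(`sum_reflections_odd`). A function of two entries that is antisymmetric, odd under a joint sign
change, zero on equal or opposite entries and of zero sum in one variable has eigenvalue `n ^ 2 - 4
* n + 2` (`sum_reflections_two`). There are `n ^ 2` reflections, which gives the bases `1 - 2 / n`
and `1 - 4 / n + 2 / n ^ 2`.

The indicator of `π_i > π_j` is `1 / 2` minus half the sign of `π_j - π_i`. That sign splits as `psi
(π_j) - psi (π_i)`, made of odd one-entry functions, plus the remainder `signTwo`; the choice of
`psi` is what makes the sums of `signTwo` vanish (`sum_signTwo`). This proves (b).

For (a), the length counts the pairs `|i| < j` with `π_i > π_j` together with the positive `i` with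
`π_{-i} > π_i` (`length_eq_sum`). By linearity the expected length is the sum of the probabilities
in (b). -/

noncomputable instance (n : ℕ) : Fintype (Idx n) := Fintype.ofFinite _

noncomputable instance (n : ℕ) : Fintype (SignedPerm n) := Fintype.ofFinite _

/-! ### Signed permutations and the explicit form of the reflections -/

theorem Idx.ne_neg (a : Idx n) : a ≠ -a := by
  have := a.2.1
  rw [Ne, Subtype.ext_iff, val_neg]
  omega

instance : CoeFun (SignedPerm n) fun _ => Idx n → Idx n := ⟨fun w => (w : Equiv.Perm (Idx n))⟩

theorem SignedPerm.ext_apply {v w : SignedPerm n} (h : ∀ x, v x = w x) : v = w :=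
  Subtype.ext (Equiv.ext h)

theorem SignedPerm.apply_neg (w : SignedPerm n) (x : Idx n) : w (-x) = -w x := w.2 x

theorem SignedPerm.apply_inj (w : SignedPerm n) {x y : Idx n} : w x = w y ↔ x = y :=
  (w : Equiv.Perm (Idx n)).injective.eq_iff

theorem SignedPerm.apply_eq_neg (w : SignedPerm n) {x y : Idx n} : w x = -w y ↔ x = -y := by
  rw [← SignedPerm.apply_neg w, SignedPerm.apply_inj w]

theorem SignedPerm.mul_apply (v w : SignedPerm n) (x : Idx n) : (v * w) x = v (w x) := rfl

theorem SignedPerm.one_apply (x : Idx n) : (1 : SignedPerm n) x = x := rfl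

/-- The map exchanging `a` with `b` and `-a` with `-b`. -/
def reflFun (a b x : Idx n) : Idx n :=
  if x = a then b else if x = b then a else if x = -a then -b else if x = -b then -a else x

theorem reflFun_val (a b x : Idx n) : (reflFun a b x : ℤ) =
    if (x : ℤ) = a then (b : ℤ) else if (x : ℤ) = b then (a : ℤ)
      else if (x : ℤ) = -a then -(b : ℤ) else if (x : ℤ) = -b then -(a : ℤ) else x := by
  unfold reflFun
  simp only [Subtype.ext_iff, val_neg]
  split_ifs <;> rfl

theorem reflFun_involutive (a b : Idx n) : Function.Involutive (reflFun a b) := by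
  intro x
  have ha := a.2.1
  have hb := b.2.1
  refine Subtype.ext ?_
  obtain ⟨y, hy⟩ : ∃ y, y = (reflFun a b x : ℤ) := ⟨_, rfl⟩
  rw [reflFun_val, ← hy]
  rw [reflFun_val] at hy
  split_ifs at hy ⊢ <;> omega

/-- The reflection exchanging `a` with `b` and `-a` with `-b`. It is the identity if `a = b`, and
the sign change of `a` if `b = -a`. -/
def refl (a b : Idx n) : SignedPerm n :=
  ⟨(reflFun_involutive a b).toPerm, fun x => by
    have ha := a.2.1
    have hb := b.2.1
    refine Subtype.ext ?_
    change (reflFun a b (-x) : ℤ) = -(reflFun a b x : ℤ)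
    rw [reflFun_val, reflFun_val, val_neg]
    split_ifs <;> omega⟩

theorem refl_apply (a b x : Idx n) : refl a b x = reflFun a b x := rfl

theorem refl_val (a b x : Idx n) : (refl a b x : ℤ) =
    if (x : ℤ) = a then (b : ℤ) else if (x : ℤ) = b then (a : ℤ)
      else if (x : ℤ) = -a then -(b : ℤ) else if (x : ℤ) = -b then -(a : ℤ) else x :=
  reflFun_val a b x

theorem refl_apply_left (a b : Idx n) : refl a b a = b := if_pos rfl

theorem refl_apply_of_ne {a b x : Idx n} (h1 : x ≠ a) (h2 : x ≠ b) (h3 : x ≠ -a) (h4 : x ≠ -b) :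
    refl a b x = x := by
  rw [refl_apply, reflFun, if_neg h1, if_neg h2, if_neg h3, if_neg h4]

theorem refl_comm (a b : Idx n) : refl a b = refl b a := by
  refine entry_ext fun x => ?_
  change (refl a b x : ℤ) = (refl b a x : ℤ)
  rw [refl_val, refl_val]
  split_ifs <;> omega

theorem refl_neg (a b : Idx n) : refl (-a) (-b) = refl a b := by
  refine entry_ext fun x => ?_
  change (refl (-a) (-b) x : ℤ) = (refl a b x : ℤ)
  have ha := a.2.1
  have hb := b.2.1
  rw [refl_val, refl_val, val_neg, val_neg]
  split_ifs <;> omega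

theorem refl_apply_right (a b : Idx n) : refl a b b = a := by rw [refl_comm, refl_apply_left]

theorem conj_refl (w : SignedPerm n) (a b : Idx n) :
    w * refl a b * w⁻¹ = refl (w a) (w b) := by
  rw [mul_inv_eq_iff_eq_mul]
  refine SignedPerm.ext_apply fun x => ?_
  rw [SignedPerm.mul_apply, SignedPerm.mul_apply, refl_apply, refl_apply, reflFun, reflFun]
  simp only [SignedPerm.apply_inj w, SignedPerm.apply_eq_neg w]
  split_ifs <;> simp only [SignedPerm.apply_neg w]

/-- The left end of the interval inverted by `gen p`. -/
def lo (p : Fin n) : Idx n := if h : (p : ℕ) = 0 then -pos p p.2 else pos (p - 1) (by omega)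

theorem lo_val (p : Fin n) : (lo p : ℤ) = if (p : ℕ) = 0 then -1 else (p : ℤ) := by
  unfold lo
  split_ifs with h
  · rw [val_neg, pos]; simp [h]
  · simp only [pos]; omega

theorem pos_val (p : ℕ) (hp : p < n) : (pos p hp : ℤ) = p + 1 := rfl

theorem gen_eq_refl (p : Fin n) : gen p = refl (lo p) (pos p p.2) := by
  refine entry_ext fun x => ?_
  change (genPerm p x : ℤ) = (refl _ _ x : ℤ)
  rw [genPerm_val, refl_val, lo_val, pos_val, act]
  split_ifs <;> omega

theorem lo_ne_pos (p : Fin n) : lo p ≠ pos p p.2 := by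
  rw [Ne, Subtype.ext_iff, lo_val, pos_val]
  split_ifs <;> omega

theorem mem_reflections {w : SignedPerm n} :
    w ∈ reflections n ↔ (coxeterSystem n).IsReflection w := by
  simp [reflections]

theorem isReflection_gen (p : Fin n) : (coxeterSystem n).IsReflection (gen p) := by
  have h := (coxeterSystem n).isReflection_simple p.rev
  rwa [coxeterSystem_simple, Fin.rev_rev] at h

/-- There are two kinds: sign changes are conjugate to `gen 0`, and the rest to `gen 1`. A
conjugator only has to carry the points exchanged by the generator to `a` and `b`. -/
theorem isReflection_refl {a b : Idx n} (hab : a ≠ b) :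
    (coxeterSystem n).IsReflection (refl a b) := by
  have hn : 0 < n := by
    have := abs_pos.mpr a.2.1
    have := a.2.2
    omega
  have g0 : gen ⟨0, hn⟩ = refl (-pos 0 hn) (pos 0 hn) := gen_eq_refl (n := n) ⟨0, hn⟩
  by_cases h : b = -a
  · have key := (isReflection_gen ⟨0, hn⟩).conj (refl (pos 0 hn) a)
    rw [g0, conj_refl, SignedPerm.apply_neg, refl_apply_left, refl_comm] at key
    rwa [h]
  · have hn1 : 1 < n := by
      have h1 := a.2.2
      have h2 := b.2.2
      have h3 := a.2.1
      have h4 := b.2.1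
      rw [Subtype.ext_iff, val_neg] at h
      rw [Ne, Subtype.ext_iff] at hab
      rw [abs_le] at h1 h2
      omega
    have g1 : gen ⟨1, hn1⟩ = refl (pos 0 hn) (pos 1 hn1) := gen_eq_refl (n := n) ⟨1, hn1⟩
    -- The point `c` is the preimage of `b` under the reflection taking `1` to `a`. Moving `2` to
    -- `c` first leaves `1` in place, because `b ≠ ±a` gives `c ≠ ±1`; the composite then sends `1`
    -- to `a` and `2` to `b`.
    set c := refl (pos 0 hn) a b with hc
    have hca : refl (pos 0 hn) a c = b := reflFun_involutive _ _ b
    have hc1 : c ≠ pos 0 hn := by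
      intro e
      rw [e, refl_apply_left] at hca
      exact hab hca
    have hc2 : c ≠ -pos 0 hn := by
      intro e
      rw [e, SignedPerm.apply_neg, refl_apply_left] at hca
      exact h hca.symm
    have key := (isReflection_gen ⟨1, hn1⟩).conj (refl (pos 0 hn) a * refl (pos 1 hn1) c)
    rw [g1, conj_refl, SignedPerm.mul_apply, SignedPerm.mul_apply, refl_apply_left, hca,
      refl_apply_of_ne (x := pos 0 hn), refl_apply_left] at key
    · exact key
    · rw [Ne, Subtype.ext_iff, pos_val, pos_val]; omega
    · exact hc1.symm
    · rw [Ne, Subtype.ext_iff, val_neg, pos_val, pos_val]; omega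
    · rintro e
      rw [e, neg_neg] at hc2
      exact hc2 rfl

theorem mem_reflections_iff {w : SignedPerm n} :
    w ∈ reflections n ↔ ∃ a b, a ≠ b ∧ w = refl a b := by
  rw [mem_reflections]
  constructor
  · rintro ⟨v, k, rfl⟩
    refine ⟨v (lo k.rev), v (pos k.rev k.rev.2), ?_, ?_⟩
    · rw [Ne, SignedPerm.apply_inj v]; exact lo_ne_pos _
    · rw [coxeterSystem_simple, gen_eq_refl, conj_refl]
  · rintro ⟨a, b, hab, rfl⟩
    exact isReflection_refl hab

/-- A reflection is determined by any one point that it moves and the image of that point. Hence the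
reflections moving `i` are parametrized by the points `b ≠ i`, as used in
`sum_reflections_apply_ne`. -/
theorem eq_refl_of_apply_ne {r : SignedPerm n} (hr : r ∈ reflections n) {i : Idx n}
    (hi : r i ≠ i) : r = refl i (r i) := by
  obtain ⟨a, b, -, rfl⟩ := mem_reflections_iff.mp hr
  by_cases h1 : i = a
  · rw [h1, refl_apply_left]
  by_cases h2 : i = b
  · rw [h2, refl_apply_right, refl_comm]
  by_cases h3 : i = -a
  · rw [h3, SignedPerm.apply_neg, refl_apply_left, refl_neg]
  by_cases h4 : i = -b
  · rw [h4, SignedPerm.apply_neg, refl_apply_right, refl_neg, refl_comm]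
  exact absurd (refl_apply_of_ne h1 h2 h3 h4) hi

theorem sum_reflections_apply_ne {A : Type*} [AddCommMonoid A] (i : Idx n)
    (G : SignedPerm n → A) :
    ∑ r ∈ reflections n with r i ≠ i, G r = ∑ b with b ≠ i, G (refl i b) := by
  refine Finset.sum_nbij' (fun r => r i) (fun b => refl i b) ?_ ?_ ?_ ?_ ?_
  · intro r hr
    simpa using (Finset.mem_filter.mp hr).2
  · intro b hb
    have hb' : b ≠ i := by simpa using hb
    rw [Finset.mem_filter, refl_apply_left]
    exact ⟨mem_reflections_iff.mpr ⟨i, b, hb'.symm, rfl⟩, hb'⟩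
  · intro r hr
    rw [Finset.mem_filter] at hr
    exact (eq_refl_of_apply_ne hr.1 hr.2).symm
  · intro b _
    exact refl_apply_left i b
  · intro r hr
    rw [Finset.mem_filter] at hr
    rw [← eq_refl_of_apply_ne hr.1 hr.2]

/-! ### Sums over the index set and the number of reflections -/

theorem sum_idx {A : Type*} [AddCommMonoid A] (f : ℤ → A) :
    ∑ k : Idx n, f k = ∑ p ∈ Finset.range n, (f (p + 1) + f (-(p + 1))) := by
  have h : (Finset.range n).image (fun p : ℕ => (p : ℤ) + 1) ∪
      (Finset.range n).image (fun p : ℕ => -((p : ℤ) + 1)) =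
      (Finset.univ : Finset (Idx n)).image Subtype.val := by
    ext k
    simp only [Finset.mem_union, Finset.mem_image, Finset.mem_range, Finset.mem_univ, true_and,
      Subtype.exists, exists_prop, exists_eq_right, abs_le]
    constructor
    · rintro (⟨p, hp, rfl⟩ | ⟨p, hp, rfl⟩) <;> omega
    · rintro ⟨h0, h1, h2⟩
      rcases lt_or_gt_of_ne h0 with h | h
      · exact Or.inr ⟨(-k - 1).toNat, by omega, by omega⟩
      · exact Or.inl ⟨(k - 1).toNat, by omega, by omega⟩
  have h2 := Finset.sum_image (f := f) (s := (Finset.univ : Finset (Idx n))) (g := Subtype.val)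
    Subtype.val_injective.injOn
  rw [← h, Finset.sum_union, Finset.sum_image, Finset.sum_image,
    ← Finset.sum_add_distrib] at h2
  · exact h2.symm
  · intro a _ b _ hab
    simpa using hab
  · intro a _ b _ hab
    simpa using hab
  · rw [Finset.disjoint_left]
    intro k
    simp only [Finset.mem_image, Finset.mem_range]
    rintro ⟨p, -, rfl⟩ ⟨q, -, h⟩
    omega

theorem sum_neg_idx {A : Type*} [AddCommMonoid A] (f : Idx n → A) :
    ∑ k, f (-k) = ∑ k, f k :=
  Equiv.sum_comp (Equiv.neg (Idx n)) f

theorem card_idx : Fintype.card (Idx n) = 2 * n := by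
  have h := sum_idx (n := n) fun _ => 1
  simp only [Finset.sum_const, Finset.card_univ, smul_eq_mul, mul_one, Finset.card_range] at h
  omega

theorem sum_Ico_neg (m : ℤ) (N : ℕ) :
    ∑ p ∈ Finset.range N, ((if -m ≤ (p : ℤ) + 1 ∧ (p : ℤ) + 1 < m then (1 : ℤ) else 0) +
      (if -m ≤ -((p : ℤ) + 1) ∧ -((p : ℤ) + 1) < m then 1 else 0)) =
    if m ≤ 0 then 0 else if (N : ℤ) < m then 2 * (N : ℤ) else 2 * m - 1 := by
  induction N with
  | zero => simp only [Finset.range_zero, Finset.sum_empty]; split_ifs <;> omega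
  | succ N ih =>
    rw [Finset.sum_range_succ, ih]
    push_cast
    split_ifs <;> omega

/-- Every reflection has a unique normal form `refl b m` with `-m ≤ b < m`; here `m` is the largest
point that it moves. -/
theorem card_reflections_eq_sum : ((reflections n).card : ℤ) =
    ∑ m : Idx n, ∑ b : Idx n, if -(m : ℤ) ≤ b ∧ (b : ℤ) < m then 1 else 0 := by
  rw [← Finset.sum_product', ← Finset.sum_filter, Finset.sum_const, nsmul_eq_mul, mul_one,
    Nat.cast_inj]
  refine (Finset.card_bij (fun x _ => refl x.2 x.1) ?_ ?_ ?_).symm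
  · intro x hx
    refine mem_reflections_iff.mpr ⟨_, _, ?_, rfl⟩
    rw [Finset.mem_filter] at hx
    rw [Ne, Subtype.ext_iff]
    omega
  · have key : ∀ x y : Idx n × Idx n, (-(x.1 : ℤ) ≤ x.2 ∧ (x.2 : ℤ) < x.1) →
        (-(y.1 : ℤ) ≤ y.2 ∧ (y.2 : ℤ) < y.1) → refl x.2 x.1 = refl y.2 y.1 →
        (y.1 : ℤ) ≤ x.1 := by
      intro x y hx hy h
      by_contra hlt
      have h1 : refl x.2 x.1 y.1 = y.1 := by
        apply refl_apply_of_ne <;> simp only [Ne, Subtype.ext_iff, val_neg] <;> omega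
      rw [h, refl_apply_right, Subtype.ext_iff] at h1
      omega
    intro x hx y hy h
    rw [Finset.mem_filter] at hx hy
    have e : x.1 = y.1 :=
      Subtype.ext (le_antisymm (key y x hy.2 hx.2 h.symm) (key x y hx.2 hy.2 h))
    refine Prod.ext e ?_
    have h1 := refl_apply_right x.2 x.1
    rw [h, e, refl_apply_right] at h1
    exact h1.symm
  · intro r hr
    obtain ⟨a, b, hab, rfl⟩ := mem_reflections_iff.mp hr
    -- The point of larger absolute value becomes `m`, after negating both points if it is negative.
    have key : ∀ a b : Idx n, a ≠ b → |(a : ℤ)| ≤ |(b : ℤ)| →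
        ∃ x : Idx n × Idx n, (-(x.1 : ℤ) ≤ x.2 ∧ (x.2 : ℤ) < x.1) ∧ refl x.2 x.1 = refl a b := by
      intro a b hab h
      have hb := b.2.1
      rw [Ne, Subtype.ext_iff] at hab
      rcases lt_or_gt_of_ne hb with hb | hb
      · refine ⟨(-b, -a), ?_, refl_neg a b⟩
        rw [abs_of_neg hb, abs_le] at h
        simp only [val_neg]
        omega
      · refine ⟨(b, a), ?_, rfl⟩
        rw [abs_of_pos hb, abs_le] at h
        dsimp only
        omega
    have : ∃ x : Idx n × Idx n, (-(x.1 : ℤ) ≤ x.2 ∧ (x.2 : ℤ) < x.1) ∧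
        refl x.2 x.1 = refl a b := by
      rcases le_total |(a : ℤ)| |(b : ℤ)| with h | h
      · exact key a b hab h
      · rw [refl_comm a b]
        exact key b a hab.symm h
    obtain ⟨x, h1, h2⟩ := this
    exact ⟨x, Finset.mem_filter.mpr ⟨Finset.mem_product.mpr ⟨Finset.mem_univ _, Finset.mem_univ _⟩,
      h1⟩, h2⟩

theorem card_reflections : (reflections n).card = n ^ 2 := by
  have h1 : ∀ m : Idx n, ∑ b : Idx n, (if -(m : ℤ) ≤ b ∧ (b : ℤ) < m then (1 : ℤ) else 0) =
      if (m : ℤ) ≤ 0 then 0 else 2 * (m : ℤ) - 1 := by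
    intro m
    rw [sum_idx (fun b : ℤ => if -(m : ℤ) ≤ b ∧ b < m then (1 : ℤ) else 0), sum_Ico_neg]
    have := (abs_le.mp m.2.2).2
    split_ifs <;> omega
  have h2 : ∀ N : ℕ, ∑ p ∈ Finset.range N, ((if (p : ℤ) + 1 ≤ 0 then 0 else 2 * ((p : ℤ) + 1) - 1) +
      (if -((p : ℤ) + 1) ≤ 0 then 0 else 2 * (-((p : ℤ) + 1)) - 1)) = (N : ℤ) ^ 2 := by
    intro N
    induction N with
    | zero => rfl
    | succ N ih =>
      rw [Finset.sum_range_succ, ih, if_neg (by omega), if_pos (by omega)]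
      push_cast
      ring
  have h := card_reflections_eq_sum (n := n)
  simp only [h1] at h
  rw [sum_idx (fun m : ℤ => if m ≤ 0 then (0 : ℤ) else 2 * m - 1), h2] at h
  exact_mod_cast h

theorem sign_eq_ite (x : ℤ) : Int.sign x = if 0 < x then 1 else if x < 0 then -1 else 0 := by
  rcases lt_trichotomy x 0 with h | h | h
  · rw [Int.sign_eq_neg_one_of_neg h, if_neg (by omega), if_pos h]
  · subst h; rfl
  · rw [Int.sign_eq_one_of_pos h, if_pos h]

theorem sum_sign_sub (j : Idx n) :
    ∑ b : Idx n, Int.sign ((j : ℤ) - b) = 2 * j - Int.sign j := by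
  -- The truncation `N` is decoupled from `n` so that induction applies; the case `N < |j|`, where
  -- all signs agree, does not occur at `N = n`.
  have key : ∀ j : ℤ, ∀ N : ℕ, ∑ p ∈ Finset.range N,
      (Int.sign (j - (p + 1)) + Int.sign (j - -((p : ℤ) + 1))) =
      if 0 < j then (if (N : ℤ) < j then 2 * (N : ℤ) else 2 * j - 1) else
        if j < 0 then (if (N : ℤ) < -j then -2 * (N : ℤ) else 2 * j + 1) else 0 := by
    intro j N
    induction N with
    | zero => simp only [Finset.range_zero, Finset.sum_empty]; split_ifs <;> omega
    | succ N ih =>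
      rw [Finset.sum_range_succ, ih, sign_eq_ite, sign_eq_ite]
      push_cast
      split_ifs <;> omega
  rw [sum_idx (fun b : ℤ => Int.sign ((j : ℤ) - b)), key, sign_eq_ite]
  have h0 := j.2.1
  have h1 := abs_le.mp j.2.2
  split_ifs <;> omega

/-! ### Eigenfunctions of the sum over all reflections -/

theorem sum_odd_eq_zero {g : Idx n → ℝ} (hg : ∀ k, g (-k) = -g k) : ∑ k, g k = 0 := by
  have h := sum_neg_idx g
  simp only [hg, Finset.sum_neg_distrib] at h
  linarith

/-- Every odd function of one entry is an eigenfunction of the sum over all reflections. -/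
theorem sum_reflections_odd {g : Idx n → ℝ} (hg : ∀ k, g (-k) = -g k) (i : Idx n) :
    ∑ r ∈ reflections n, g (r i) = ((n : ℝ) ^ 2 - 2 * n) * g i := by
  -- Subtracting `g i` kills the reflections fixing `i`. The others send `i` to each `b ≠ i` exactly
  -- once, and `b = i` adds zero. By oddness the right side is `-2 * n * g i`.
  have h1 : ∑ r ∈ reflections n, (g (r i) - g i) = ∑ b, (g b - g i) := by
    rw [← Finset.sum_filter_of_ne (p := fun r => r i ≠ i),
      sum_reflections_apply_ne i fun r => g (r i) - g i]
    · simp only [refl_apply_left]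
      refine Finset.sum_filter_of_ne ?_
      rintro b - h rfl
      exact h (sub_self _)
    · intro r _ h e
      exact h (by rw [e, sub_self])
  rw [Finset.sum_sub_distrib, Finset.sum_sub_distrib, sum_odd_eq_zero hg, Finset.sum_const,
    Finset.sum_const, card_reflections, Finset.card_univ, card_idx, nsmul_eq_mul,
    nsmul_eq_mul] at h1
  push_cast at h1
  linarith

/-- Eigenfunctions of two entries of the sum over all reflections. -/
theorem sum_reflections_two {h : Idx n → Idx n → ℝ} (h0 : ∀ a, h a a = 0)
    (h0' : ∀ a, h a (-a) = 0) (hanti : ∀ a b, h b a = -h a b)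
    (hneg : ∀ a b, h (-a) (-b) = -h a b) (hsum : ∀ j, ∑ b, h b j = 0) (i j : Idx n) :
    ∑ r ∈ reflections n, h (r i) (r j) = ((n : ℝ) ^ 2 - 4 * n + 2) * h i j := by
  by_cases hij : i = j
  · subst hij
    simp only [h0, Finset.sum_const_zero, mul_zero]
  by_cases hij' : j = -i
  · subst hij'
    simp only [SignedPerm.apply_neg, h0', Finset.sum_const_zero, mul_zero]
  have hij2 : i ≠ -j := fun e => hij' (by rw [e, neg_neg])
  have h0'' : ∀ a, h (-a) a = 0 := fun a => by rw [hanti, h0', neg_zero]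
  have hsum' : ∑ b, h i b = 0 := by
    rw [← neg_eq_zero, ← hsum i, ← Finset.sum_neg_distrib]
    exact Finset.sum_congr rfl fun b _ => (hanti i b).symm
  set D : SignedPerm n → ℝ := fun r => h (r i) (r j) - h i j with hD
  -- The increment `D r` vanishes when `r` fixes both points, so either `r` moves `i`, or it fixes
  -- `i` and moves `j`.
  have split : ∑ r ∈ reflections n, D r = ∑ r ∈ reflections n with r i ≠ i, D r +
      ∑ r ∈ reflections n with r j ≠ j, (if r i = i then D r else 0) := by
    rw [← Finset.sum_filter_add_sum_filter_not (reflections n) (fun r => r i ≠ i) D]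
    congr 1
    simp only [not_not]
    rw [Finset.sum_filter, Finset.sum_filter]
    refine Finset.sum_congr rfl fun r _ => ?_
    by_cases e : r i = i
    · by_cases e' : r j = j
      · rw [if_pos e, if_neg (by simpa using e'), hD]
        dsimp only
        rw [e, e', sub_self]
      · rw [if_pos e, if_pos e']
    · rw [if_neg e, ite_self]
  -- The reflection `refl i b` generally leaves `j` alone. The two correction terms handle `b = j`
  -- and `b = -j`, where `j` goes to `i` and to `-i`; their contributions `h j i` and `h (-j) (-i)`
  -- cancel.
  have part1 : ∑ r ∈ reflections n with r i ≠ i, D r =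
      ∑ b, (h b j - h i j + (if b = j then h j i else 0) +
        (if b = -j then h (-j) (-i) else 0)) := by
    rw [sum_reflections_apply_ne, Finset.sum_filter]
    refine Finset.sum_congr rfl fun b _ => ?_
    simp only [hD, refl_apply_left]
    by_cases hb : b = i
    · rw [if_neg (by simpa using hb), hb, if_neg hij, if_neg hij2]
      ring
    rw [if_pos hb]
    by_cases hb1 : b = j
    · rw [hb1, refl_apply_right, if_pos rfl, if_neg (Idx.ne_neg j), h0]
      ring
    by_cases hb2 : b = -j
    · have e : refl i b j = -i := by
        rw [hb2, ← refl_neg, neg_neg, refl_apply_right]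
      rw [e, hb2, if_neg (Idx.ne_neg j).symm, if_pos rfl, h0'']
      ring
    · rw [refl_apply_of_ne (Ne.symm hij) (Ne.symm hb1) hij'
        (fun e => hb2 (by rw [e, neg_neg])), if_neg hb1, if_neg hb2]
      ring
  -- For `b = i` and `b = -i` the reflection `refl j b` also moves `i` and was already counted; the
  -- corrections restore the value zero. They do not cancel, whence the `+ 2` in the eigenvalue.
  have part2 : ∑ r ∈ reflections n with r j ≠ j, (if r i = i then D r else 0) =
      ∑ b, (h i b - h i j + (if b = i then h i j else 0) + (if b = -i then h i j else 0)) := by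
    rw [sum_reflections_apply_ne j fun r => if r i = i then D r else 0, Finset.sum_filter]
    refine Finset.sum_congr rfl fun b _ => ?_
    simp only [hD, refl_apply_left]
    by_cases hb : b = j
    · rw [if_neg (by simpa using hb), hb, if_neg (Ne.symm hij), if_neg hij']
      ring
    rw [if_pos hb]
    by_cases hb1 : b = i
    · rw [hb1, refl_apply_right, if_neg (Ne.symm hij), if_pos rfl, if_neg (Idx.ne_neg i), h0]
      ring
    by_cases hb2 : b = -i
    · have e : refl j b i = -j := by
        rw [hb2, ← refl_neg, neg_neg, refl_apply_right]
      rw [e, if_neg (Ne.symm hij2), hb2, if_neg (Idx.ne_neg i).symm, if_pos rfl, h0']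
      ring
    · have e : refl j b i = i := refl_apply_of_ne hij (Ne.symm hb1) hij2
        (fun e => hb2 (by rw [e, neg_neg]))
      rw [if_pos e, e, if_neg hb1, if_neg hb2]
      ring
  have total : ∑ r ∈ reflections n, D r = -(4 * n - 2) * h i j := by
    rw [split, part1, part2]
    simp only [Finset.sum_add_distrib, Finset.sum_sub_distrib, hsum, hsum', Finset.sum_const,
      Finset.card_univ, card_idx, nsmul_eq_mul, Finset.sum_ite_eq', Finset.mem_univ, if_true,
      hneg j i, hanti i j]
    push_cast
    ring
  simp only [hD, Finset.sum_sub_distrib, Finset.sum_const, card_reflections, nsmul_eq_mul] at total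
  push_cast at total
  linarith

/-! ### Averages over products of random elements -/

/-- The expected value of a real function at a product of `t` random elements of `R`. -/
noncomputable def avg {M : Type*} [Monoid M] (R : Finset M) (t : ℕ) (f : M → ℝ) : ℝ :=
  (∑ r : Fin t → R, f (List.ofFn fun k => (r k : M)).prod) / (R.card : ℝ) ^ t

section Average

variable {M : Type*} [Monoid M] {R : Finset M}

theorem avg_add (t : ℕ) (f g : M → ℝ) :
    avg R t (fun x => f x + g x) = avg R t f + avg R t g := by
  simp only [avg, Finset.sum_add_distrib, add_div]

theorem avg_sub (t : ℕ) (f g : M → ℝ) :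
    avg R t (fun x => f x - g x) = avg R t f - avg R t g := by
  simp only [avg, Finset.sum_sub_distrib, sub_div]

theorem avg_div (t : ℕ) (f : M → ℝ) (c : ℝ) :
    avg R t (fun x => f x / c) = avg R t f / c := by
  simp only [avg, ← Finset.sum_div]
  rw [div_right_comm]

theorem avg_sum {ι : Type*} (s : Finset ι) (t : ℕ) (f : ι → M → ℝ) :
    avg R t (fun x => ∑ i ∈ s, f i x) = ∑ i ∈ s, avg R t (f i) := by
  simp only [avg]
  rw [Finset.sum_comm, Finset.sum_div]

/-- Summing over the leftmost factor, with the others held fixed, produces one factor `R.card * c`;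
induction on `t` does the rest. -/
theorem avg_eigen (hR : R.card ≠ 0) {f : M → ℝ} {c : ℝ}
    (h : ∀ x, ∑ y ∈ R, f (y * x) = R.card * c * f x) (t : ℕ) : avg R t f = c ^ t * f 1 := by
  have hR' : (R.card : ℝ) ≠ 0 := Nat.cast_ne_zero.mpr hR
  have key : ∑ r : Fin t → R, f (List.ofFn fun k => (r k : M)).prod =
      (R.card * c) ^ t * f 1 := by
    induction t with
    | zero => simp
    | succ t ih =>
      rw [← (Fin.consEquiv fun _ : Fin (t + 1) => (R : Type _)).sum_comp, Fintype.sum_prod_type,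
        Finset.sum_comm]
      have : ∀ r : Fin t → R, ∑ y : R, f (List.ofFn fun k =>
          ((Fin.consEquiv fun _ : Fin (t + 1) => (R : Type _)) (y, r) k : M)).prod =
          R.card * c * f (List.ofFn fun k => (r k : M)).prod := by
        intro r
        rw [← h, ← Finset.sum_coe_sort R]
        refine Finset.sum_congr rfl fun y _ => ?_
        rw [List.ofFn_succ, List.prod_cons]
        rfl
      simp only [this]
      rw [← Finset.mul_sum, ih, pow_succ]
      ring
  rw [avg, key, mul_pow, mul_assoc, mul_div_cancel_left₀ _ (pow_ne_zero _ hR')]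

theorem avg_const (hR : R.card ≠ 0) (t : ℕ) (c : ℝ) : avg R t (fun _ => c) = c := by
  rw [avg_eigen hR (c := 1) (fun x => by simp), one_pow, one_mul]

theorem prob_eq_avg (P : M → Prop) [DecidablePred P] (t : ℕ) :
    prob R P t = avg R t fun x => if P x then 1 else 0 := by
  rw [prob, avg, Finset.sum_boole]
  congr!

theorem expected_eq_avg (φ : M → ℕ) (t : ℕ) : expected R φ t = avg R t fun x => (φ x : ℝ) := rfl

end Average

theorem avg_odd (hn : 1 ≤ n) {g : Idx n → ℝ} (hg : ∀ k, g (-k) = -g k) (i : Idx n) (t : ℕ) :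
    avg (reflections n) t (fun w => g (w i)) = (1 - 2 / (n : ℝ)) ^ t * g i := by
  have hn' : (n : ℝ) ≠ 0 := by positivity
  refine avg_eigen (by rw [card_reflections]; positivity) (fun x => ?_) t
  simp only [SignedPerm.mul_apply]
  rw [sum_reflections_odd hg, card_reflections]
  push_cast
  field_simp

theorem avg_two (hn : 1 ≤ n) {h : Idx n → Idx n → ℝ} (h0 : ∀ a, h a a = 0)
    (h0' : ∀ a, h a (-a) = 0) (hanti : ∀ a b, h b a = -h a b)
    (hneg : ∀ a b, h (-a) (-b) = -h a b) (hsum : ∀ j, ∑ b, h b j = 0) (i j : Idx n) (t : ℕ) :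
    avg (reflections n) t (fun w => h (w i) (w j)) =
      (1 - 4 / (n : ℝ) + 2 / (n : ℝ) ^ 2) ^ t * h i j := by
  have hn' : (n : ℝ) ≠ 0 := by positivity
  refine avg_eigen (by rw [card_reflections]; positivity) (fun x => ?_) t
  simp only [SignedPerm.mul_apply]
  rw [sum_reflections_two h0 h0' hanti hneg hsum, card_reflections]
  push_cast
  field_simp

/-! ### Decomposition of the sign and the inversion probabilities -/

/-- The sign of an entry, as a real number. -/
def sgn (k : Idx n) : ℝ := (Int.sign (k : ℤ) : ℝ)

theorem sgn_neg (k : Idx n) : sgn (-k) = -sgn k := by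
  rw [sgn, sgn, val_neg, Int.sign_neg, Int.cast_neg]

theorem sgn_of_pos {k : Idx n} (h : 0 < (k : ℤ)) : sgn k = 1 := by
  rw [sgn, Int.sign_eq_one_of_pos h, Int.cast_one]

/-- `k - sgn k`, normalized so that it takes values between `-1` and `1`. -/
noncomputable def psi (k : Idx n) : ℝ := (((k : ℤ) : ℝ) - sgn k) / ((n : ℝ) - 1)

theorem psi_neg (k : Idx n) : psi (-k) = -psi k := by
  rw [psi, psi, sgn_neg, val_neg, Int.cast_neg]
  ring

/-- The part of the sign of `j - i` not explained by one-entry functions. -/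
noncomputable def signTwo (i j : Idx n) : ℝ :=
  if j = i ∨ j = -i then 0 else (Int.sign ((j : ℤ) - i) : ℝ) - (psi j - psi i)

theorem signTwo_anti (i j : Idx n) : signTwo j i = -signTwo i j := by
  unfold signTwo
  by_cases h : j = i ∨ j = -i
  · rw [if_pos h, if_pos, neg_zero]
    rcases h with rfl | rfl
    · exact Or.inl rfl
    · exact Or.inr (neg_neg i).symm
  · rw [if_neg h, if_neg, ← neg_sub (j : ℤ) i, Int.sign_neg, Int.cast_neg]
    · ring
    · rintro (rfl | rfl)
      · exact h (Or.inl rfl)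
      · exact h (Or.inr (neg_neg j).symm)

theorem signTwo_neg (i j : Idx n) : signTwo (-i) (-j) = -signTwo i j := by
  unfold signTwo
  simp only [neg_inj]
  split_ifs
  · rw [neg_zero]
  · rw [psi_neg, psi_neg, val_neg, val_neg, ← neg_sub' (j : ℤ) i, Int.sign_neg, Int.cast_neg]
    ring

theorem sign_two_mul (x : ℤ) : Int.sign (2 * x) = Int.sign x := by
  rw [Int.sign_mul]
  exact one_mul _

/-- The signs of `j - b` sum to `2 * j - sgn j`, the differences `psi j - psi b` to `2 * n * psi j`,
and omitting `b = -j` removes `sgn j - 2 * psi j`. What remains is `2 * (j - sgn j) - 2 * (n - 1) *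
psi j`, so the vanishing dictates the definition of `psi`. -/
theorem sum_signTwo (hn : 1 ≤ n) (j : Idx n) : ∑ b, signTwo b j = 0 := by
  have h1 : ∀ b : Idx n, signTwo b j = ((Int.sign ((j : ℤ) - b) : ℝ) - (psi j - psi b)) -
      (if b = -j then (sgn j - 2 * psi j) else 0) := by
    intro b
    have hb : b = -j ↔ j = -b := ⟨fun h => by rw [h, neg_neg], fun h => by rw [h, neg_neg]⟩
    unfold signTwo
    by_cases h1 : j = b
    · rw [if_pos (Or.inl h1), if_neg (by rw [← h1]; exact Idx.ne_neg j), h1]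
      simp
    · by_cases h2 : j = -b
      · rw [if_pos (Or.inr h2), if_pos (hb.mpr h2), hb.mpr h2, psi_neg, val_neg, sub_neg_eq_add,
          sgn, ← two_mul, sign_two_mul]
        ring
      · rw [if_neg (by tauto), if_neg (by tauto), sub_zero]
  have h2 := sum_sign_sub j
  have h3 : ∑ b : Idx n, (Int.sign ((j : ℤ) - b) : ℝ) = 2 * ((j : ℤ) : ℝ) - sgn j := by
    rw [sgn]; exact_mod_cast h2
  simp only [h1, Finset.sum_sub_distrib, h3, sum_odd_eq_zero psi_neg, Finset.sum_ite_eq',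
    Finset.mem_univ, if_true, Finset.sum_const, Finset.card_univ, card_idx, nsmul_eq_mul]
  push_cast
  -- For `n = 1` division by zero makes `psi` zero, which is consistent because then `j = sgn j`.
  by_cases hn1 : n = 1
  · subst hn1
    have hj := j.2
    rw [abs_le] at hj
    have : (j : ℤ) = sgn j := by
      rw [sgn, Int.cast_inj, sign_eq_ite]
      split_ifs <;> omega
    rw [psi, this]
    simp
    ring
  · have : (n : ℝ) - 1 ≠ 0 := sub_ne_zero.mpr (by exact_mod_cast hn1)
    rw [psi]
    field_simp
    ring

theorem ite_gt_eq_sign {x y : ℤ} (h : x ≠ y) :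
    (if x > y then (1 : ℝ) else 0) = 1 / 2 - (Int.sign (y - x) : ℝ) / 2 := by
  rw [sign_eq_ite]
  rcases lt_or_gt_of_ne h with h | h
  · rw [if_neg (by omega), if_pos (by omega)]
    norm_num
  · rw [if_pos (by omega), if_neg (by omega), if_pos (by omega)]
    norm_num

theorem entry_neg (w : SignedPerm n) (i : Idx n) : entry w (-i) = -entry w i :=
  congrArg Subtype.val (w.2 i)

theorem prob_entry_neg_gt (hn : 1 ≤ n) (i : Idx n) (hi : 1 ≤ (i : ℤ)) (t : ℕ) :
    prob (reflections n) (fun w => entry w (-i) > entry w i) t =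
      1 / 2 - 1 / 2 * (1 - 2 / (n : ℝ)) ^ t := by
  have hR : (reflections n).card ≠ 0 := by rw [card_reflections]; positivity
  have key : ∀ w : SignedPerm n, (if entry w (-i) > entry w i then (1 : ℝ) else 0) =
      1 / 2 - sgn (w i) / 2 := by
    intro w
    have h0 := (w i).2.1
    change entry w i ≠ 0 at h0
    rw [entry_neg, ite_gt_eq_sign (by omega), sub_neg_eq_add, ← two_mul, sign_two_mul]
    rfl
  rw [prob_eq_avg]
  simp only [key]
  rw [avg_sub, avg_const hR, avg_div, avg_odd hn sgn_neg, sgn_of_pos (by omega)]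
  ring

/-- Since `j ≠ ±i`, the images are never equal or opposite, so the exceptional case of `signTwo` is
avoided for every `w`. Each part then contributes its eigenvalue power times its value at the
identity, where the sign of `j - i` is `1`. -/
theorem prob_entry_gt (hn : 1 ≤ n) (i j : Idx n) (hij : |(i : ℤ)| < (j : ℤ)) (t : ℕ) :
    prob (reflections n) (fun w => entry w i > entry w j) t =
      1 / 2 - (psi j - psi i) / 2 * (1 - 2 / (n : ℝ)) ^ t
        + ((psi j - psi i) / 2 - 1 / 2) * (1 - 4 / (n : ℝ) + 2 / (n : ℝ) ^ 2) ^ t := by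
  have hR : (reflections n).card ≠ 0 := by rw [card_reflections]; positivity
  rw [abs_lt] at hij
  have h1 : j ≠ i := by rw [Ne, Subtype.ext_iff]; omega
  have h2 : j ≠ -i := by rw [Ne, Subtype.ext_iff, val_neg]; omega
  have key : ∀ w : SignedPerm n, (if entry w i > entry w j then (1 : ℝ) else 0) =
      1 / 2 - (signTwo (w i) (w j) + (psi (w j) - psi (w i))) / 2 := by
    intro w
    rw [ite_gt_eq_sign, signTwo, if_neg]
    · change _ - ((Int.sign ((w j : ℤ) - w i) : ℤ) : ℝ) / 2 = _
      ring
    · rw [SignedPerm.apply_inj, SignedPerm.apply_eq_neg]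
      tauto
    · intro e
      exact h1 ((SignedPerm.apply_inj w).mp (Subtype.ext e)).symm
  have h0 : ∀ a : Idx n, signTwo a a = 0 := fun a => if_pos (Or.inl rfl)
  have h0' : ∀ a : Idx n, signTwo a (-a) = 0 := fun a => if_pos (Or.inr rfl)
  rw [prob_eq_avg]
  simp only [key]
  rw [avg_sub, avg_const hR, avg_div, avg_add, avg_sub, avg_odd hn psi_neg, avg_odd hn psi_neg,
    avg_two hn h0 h0' signTwo_anti signTwo_neg (sum_signTwo hn), signTwo, if_neg (by tauto),
    Int.sign_eq_one_of_pos (by omega)]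
  push_cast
  ring

/-! ### Coxeter length as a count of inversions -/

/-- Twice the length: the number of inversions of `w` as a permutation of `[-n, n] \ {0}`, plus
the number of negative entries at positive positions. -/
noncomputable def twiceInv (w : SignedPerm n) : ℤ :=
  (∑ i : Idx n, ∑ j : Idx n, if (i : ℤ) < j ∧ entry w j < entry w i then 1 else 0) +
    ∑ i : Idx n, if 0 < (i : ℤ) ∧ entry w i < 0 then 1 else 0

theorem twiceInv_nonneg (w : SignedPerm n) : 0 ≤ twiceInv w := by
  unfold twiceInv
  refine add_nonneg (Finset.sum_nonneg fun i _ => Finset.sum_nonneg fun j _ => ?_)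
    (Finset.sum_nonneg fun i _ => ?_) <;> split_ifs <;> norm_num

theorem twiceInv_one : twiceInv (1 : SignedPerm n) = 0 := by
  unfold twiceInv
  rw [Finset.sum_eq_zero, Finset.sum_eq_zero, add_zero]
  · intro i _
    refine if_neg ?_
    rw [entry_one]
    omega
  · intro i _
    refine Finset.sum_eq_zero fun j _ => if_neg ?_
    rw [entry_one, entry_one]
    omega

theorem gen_involutive (p : Fin n) (i : Idx n) : gen p (gen p i) = i := by
  rw [← SignedPerm.mul_apply, gen_sq, SignedPerm.one_apply]

/-- The permutation `gen p` as an equivalence. -/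
abbrev genEquiv (p : Fin n) : Idx n ≃ Idx n := (gen p : Equiv.Perm (Idx n))

theorem gen_val (p : Fin n) (i : Idx n) : (gen p i : ℤ) = act p i := genPerm_val p i

theorem entry_mul_gen (w : SignedPerm n) (p : Fin n) (i : Idx n) :
    entry (w * gen p) i = entry w (gen p i) := rfl

/-- Reindexing by the involution `gen p` moves it from the entries to the order of positions, so the
comparison with `twiceInv w` involves only the few pairs whose order it changes. -/
theorem twiceInv_mul_gen (w : SignedPerm n) (p : Fin n) : twiceInv (w * gen p) =
    (∑ i : Idx n, ∑ j : Idx n, if act p i < act p j ∧ entry w j < entry w i then 1 else 0) +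
    ∑ i : Idx n, if 0 < act p i ∧ entry w i < 0 then 1 else 0 := by
  unfold twiceInv
  simp only [entry_mul_gen]
  congr 1
  · rw [← Equiv.sum_comp (genEquiv p)]
    refine Finset.sum_congr rfl fun i _ => ?_
    rw [← Equiv.sum_comp (genEquiv p)]
    refine Finset.sum_congr rfl fun j _ => ?_
    simp only [gen_involutive, gen_val]
  · rw [← Equiv.sum_comp (genEquiv p)]
    refine Finset.sum_congr rfl fun i _ => ?_
    simp only [gen_involutive, gen_val]

theorem ite_and_eq_mul (P Q : Prop) [Decidable P] [Decidable Q] :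
    (if P ∧ Q then (1 : ℤ) else 0) = (if P then 1 else 0) * if Q then 1 else 0 := by
  split_ifs <;> simp_all

theorem sum_sum_ite_eq (a b : Idx n) (g : Idx n → Idx n → ℤ) :
    ∑ i, ∑ j, (if i = a ∧ j = b then (1 : ℤ) else 0) * g i j = g a b := by
  simp only [ite_and_eq_mul]
  simp

theorem entry_lt_iff (w : SignedPerm n) {i j : Idx n} (h : i ≠ j) :
    ¬ entry w i < entry w j ↔ entry w j < entry w i := by
  have : entry w i ≠ entry w j := fun e => h ((SignedPerm.apply_inj w).mp (Subtype.ext e))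
  omega

theorem act_cases {p : ℕ} (hp : p ≠ 0) (x : ℤ) :
    act p x = x ∧ x ≠ p ∧ x ≠ p + 1 ∧ x ≠ -p ∧ x ≠ -(p + 1) ∨ x = p ∧ act p x = p + 1 ∨
      x = p + 1 ∧ act p x = p ∨ x = -p ∧ act p x = -(p + 1) ∨ x = -(p + 1) ∧ act p x = -p := by
  unfold act
  split_ifs <;> omega

theorem act_lt_act_iff {p : ℕ} (hp : p ≠ 0) {x y : ℤ} (h1 : ¬(x = p + 1 ∧ y = p))
    (h2 : ¬(x = p ∧ y = p + 1)) (h3 : ¬(x = -p ∧ y = -(p + 1)))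
    (h4 : ¬(x = -(p + 1) ∧ y = -p)) : act p x < act p y ↔ x < y := by
  have kx := act_cases hp x
  have ky := act_cases hp y
  generalize act p x = x' at *
  generalize act p y = y' at *
  rcases kx with kx | kx | kx | kx | kx <;> rcases ky with ky | ky | ky | ky | ky <;> omega

theorem ite_act_lt_act {p : ℕ} (hp : p ≠ 0) (x y : ℤ) :
    (if act p x < act p y then (1 : ℤ) else 0) = (if x < y then 1 else 0) +
      ((if x = p + 1 ∧ y = p then 1 else 0) - (if x = p ∧ y = p + 1 then 1 else 0) +
      ((if x = -p ∧ y = -(p + 1) then 1 else 0) -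
        (if x = -(p + 1) ∧ y = -p then 1 else 0))) := by
  have kx := act_cases hp x
  have ky := act_cases hp y
  by_cases h1 : x = p + 1 ∧ y = p
  · rw [if_pos (by omega), if_neg (by omega), if_pos h1, if_neg (by omega), if_neg (by omega),
      if_neg (by omega)]
    rfl
  by_cases h2 : x = p ∧ y = p + 1
  · rw [if_neg (by omega), if_pos (by omega), if_neg h1, if_pos h2, if_neg (by omega),
      if_neg (by omega)]
    rfl
  by_cases h3 : x = -p ∧ y = -(p + 1)
  · rw [if_pos (by omega), if_neg (by omega), if_neg h1, if_neg h2, if_pos h3,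
      if_neg (by omega)]
    rfl
  by_cases h4 : x = -(p + 1) ∧ y = -p
  · rw [if_neg (by omega), if_pos (by omega), if_neg h1, if_neg h2, if_neg h3, if_pos h4]
    rfl
  rw [if_neg h1, if_neg h2, if_neg h3, if_neg h4, if_congr (act_lt_act_iff hp h1 h2 h3 h4) rfl rfl]
  ring

/-- For `p > 0` the generator reverses the order of two pairs, `(p, p + 1)` and its negative, which
are inverted or not together. For `p = 0` it reverses only `(-1, 1)`, and the count of negative
entries supplies the second unit. -/
theorem twiceInv_step (w : SignedPerm n) (p : Fin n) : twiceInv (w * gen p) =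
    twiceInv w + if entry w (lo p) < entry w (pos p p.2) then 2 else -2 := by
  set a := lo p with ha
  set b := pos p p.2 with hb
  have hav : (a : ℤ) = if (p : ℕ) = 0 then -1 else (p : ℤ) := lo_val p
  have hbv : (b : ℤ) = p + 1 := rfl
  have hlt := entry_lt_iff w (lo_ne_pos p)
  rw [← ha, ← hb] at hlt
  have hna := entry_neg w a
  have hnb := entry_neg w b
  rw [twiceInv_mul_gen, twiceInv]
  simp only [ite_and_eq_mul]
  by_cases hp : (p : ℕ) = 0
  · rw [if_pos hp] at hav
    rw [hp, Nat.cast_zero, zero_add] at hbv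
    have hab : a = -b := Subtype.ext (by rw [val_neg, hav, hbv])
    have h1 : ∀ i j : Idx n, (if act p i < act p j then (1 : ℤ) else 0) =
        (if (i : ℤ) < j then 1 else 0) + ((if i = b ∧ j = a then 1 else 0) -
          (if i = a ∧ j = b then 1 else 0)) := by
      intro i j
      simp only [Subtype.ext_iff, hav, hbv, act, hp, if_true]
      have := i.2.1
      have := j.2.1
      split_ifs <;> omega
    have h2 : ∀ i : Idx n, (if 0 < act p i then (1 : ℤ) else 0) =
        (if 0 < (i : ℤ) then 1 else 0) + ((if i = a then 1 else 0) -
          (if i = b then 1 else 0)) := by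
      intro i
      simp only [Subtype.ext_iff, hav, hbv, act, hp, if_true]
      have := i.2.1
      split_ifs <;> omega
    simp only [h1, h2, add_mul, sub_mul, Finset.sum_add_distrib, Finset.sum_sub_distrib,
      sum_sum_ite_eq]
    simp only [ite_mul, one_mul, zero_mul, Finset.sum_ite_eq', Finset.mem_univ, if_true]
    rw [hab] at hlt ⊢
    rw [hab, neg_neg] at hna
    split_ifs <;> omega
  · rw [if_neg hp] at hav
    have h1 : ∀ i j : Idx n, (if act p i < act p j then (1 : ℤ) else 0) =
        (if (i : ℤ) < j then 1 else 0) + ((if i = b ∧ j = a then 1 else 0) -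
          (if i = a ∧ j = b then 1 else 0) + ((if i = -a ∧ j = -b then 1 else 0) -
          (if i = -b ∧ j = -a then 1 else 0))) := by
      intro i j
      simp only [Subtype.ext_iff, val_neg, hav, hbv]
      exact ite_act_lt_act hp i j
    have h2 : ∀ i : Idx n, (if 0 < act p i then (1 : ℤ) else 0) =
        (if 0 < (i : ℤ) then 1 else 0) := by
      intro i
      unfold act
      split_ifs <;> omega
    simp only [h1, h2, add_mul, sub_mul, Finset.sum_add_distrib, Finset.sum_sub_distrib,
      sum_sum_ite_eq]
    split_ifs <;> omega

/-- The ascents say `0 < π_1 < ⋯ < π_n`, positivity being the ascent from `-1` to `1`. Integers in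
this chain bounded by `n` must be `1, …, n`. -/
theorem eq_one_of_ascents {w : SignedPerm n}
    (h : ∀ p : Fin n, entry w (lo p) < entry w (pos p p.2)) : w = 1 := by
  have hge : ∀ p (hp : p < n), (p : ℤ) + 1 ≤ entry w (pos p hp) := by
    intro p
    induction p with
    | zero =>
      intro hp
      have := h ⟨0, hp⟩
      have e : lo (⟨0, hp⟩ : Fin n) = -pos 0 hp := rfl
      rw [e, entry_neg] at this
      dsimp only at this
      omega
    | succ p ih =>
      intro hp
      have h1 := h ⟨p + 1, hp⟩
      have h2 := ih (by omega)
      rw [show lo (⟨p + 1, hp⟩ : Fin n) = pos p (by omega) from rfl] at h1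
      dsimp only at h1
      push_cast
      omega
  have hle : ∀ k p (hp : p < n), p + 1 + k = n → entry w (pos p hp) ≤ (p : ℤ) + 1 := by
    intro k
    induction k with
    | zero =>
      intro p hp hk
      have := (abs_le.mp (w (pos p hp)).2.2).2
      change entry w (pos p hp) ≤ n at this
      omega
    | succ k ih =>
      intro p hp hk
      have h1 := h ⟨p + 1, by omega⟩
      have e : lo (⟨p + 1, by omega⟩ : Fin n) = pos p (by omega) := rfl
      have := ih (p + 1) (by omega) (by omega)
      rw [e] at h1
      dsimp only at h1
      push_cast at this
      omega
  have hpos : ∀ i : Idx n, 0 < (i : ℤ) → entry w i = i := by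
    intro i hi
    have hin := (abs_le.mp i.2.2).2
    have hp : ((i : ℤ) - 1).toNat < n := by omega
    obtain ⟨p, hp, rfl⟩ : ∃ p, ∃ hp : p < n, i = pos p hp :=
      ⟨((i : ℤ) - 1).toNat, hp, Subtype.ext (by rw [pos_val]; omega)⟩
    exact le_antisymm (hle (n - 1 - p) _ _ (by omega)) (hge _ _)
  refine entry_ext fun i => ?_
  rw [entry_one]
  rcases lt_or_gt_of_ne i.2.1 with hi | hi
  · have := hpos (-i) (by rw [val_neg]; omega)
    rw [entry_neg, val_neg] at this
    omega
  · exact hpos i hi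

/-- Each letter of a reduced word raises `twiceInv` by at most `2`, which bounds it above.
Conversely, any `w ≠ 1` has a descent, and the corresponding generator lowers `twiceInv` by `2`, so
descending to the identity gives a short enough word. -/
theorem twiceInv_eq_length (w : SignedPerm n) :
    twiceInv w = 2 * ((coxeterSystem n).length w : ℤ) := by
  have hlen : ∀ p : Fin n, (coxeterSystem n).length (gen p) = 1 := by
    intro p
    have := (coxeterSystem n).length_simple p.rev
    rwa [coxeterSystem_simple, Fin.rev_rev] at this
  apply le_antisymm
  · obtain ⟨ω, hω, rfl⟩ := (coxeterSystem n).exists_isReduced w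
    rw [hω.eq]
    clear hω
    induction ω using List.reverseRecOn with
    | nil => simp [twiceInv_one]
    | append_singleton ω k ih =>
      rw [CoxeterSystem.wordProd_append, CoxeterSystem.wordProd_singleton, coxeterSystem_simple,
        twiceInv_step, List.length_append, List.length_singleton]
      push_cast
      split_ifs <;> omega
  · obtain ⟨N, hN⟩ : ∃ N : ℕ, twiceInv w = N := ⟨_, (Int.toNat_of_nonneg (twiceInv_nonneg w)).symm⟩
    induction N using Nat.strong_induction_on generalizing w with
    | _ N ih =>
      by_cases hw : ∀ p : Fin n, entry w (lo p) < entry w (pos p p.2)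
      · rw [eq_one_of_ascents hw, CoxeterSystem.length_one, twiceInv_one]
        norm_num
      · push Not at hw
        obtain ⟨p, hp⟩ := hw
        have hs := twiceInv_step w p
        rw [if_neg (by omega)] at hs
        have h0 := twiceInv_nonneg (w * gen p)
        have h1 := ih (N - 2) (by omega) (w * gen p) (by omega)
        have h2 := (coxeterSystem n).length_mul_le (w * gen p) (gen p)
        rw [mul_assoc, gen_sq, mul_one, hlen] at h2
        omega

/-- The involution `(i, j) ↦ (-j, -i)` preserves inversions. Its fixed ones have `i = -j` and match
the negative entries at positive positions; each other orbit has exactly one member with `|i| < j`.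
Halving `twiceInv` therefore counts each kind once. -/
theorem length_eq_sum (w : SignedPerm n) : ((coxeterSystem n).length w : ℤ) =
    (∑ i : Idx n, if 0 < (i : ℤ) ∧ entry w (-i) > entry w i then 1 else 0) +
    ∑ j : Idx n, ∑ i : Idx n, if |(i : ℤ)| < j ∧ entry w i > entry w j then 1 else 0 := by
  have h := twiceInv_eq_length w
  have hA : ∑ i : Idx n, (if 0 < (i : ℤ) ∧ entry w i < 0 then (1 : ℤ) else 0) =
      ∑ i : Idx n, if 0 < (i : ℤ) ∧ entry w (-i) > entry w i then 1 else 0 := by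
    refine Finset.sum_congr rfl fun i _ => ?_
    rw [entry_neg]
    split_ifs <;> omega
  have hB : ∑ i : Idx n, ∑ j : Idx n, (if (i : ℤ) < j ∧ entry w j < entry w i then (1 : ℤ) else 0) =
      2 * (∑ j : Idx n, ∑ i : Idx n, if |(i : ℤ)| < j ∧ entry w i > entry w j then 1 else 0) +
      ∑ i : Idx n, if 0 < (i : ℤ) ∧ entry w (-i) > entry w i then 1 else 0 := by
    have h1 : ∀ i j : Idx n, (if (i : ℤ) < j ∧ entry w j < entry w i then (1 : ℤ) else 0) =
        (if |(i : ℤ)| < j ∧ entry w i > entry w j then 1 else 0) +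
        (if |((-j : Idx n) : ℤ)| < (-i : Idx n) ∧ entry w (-j) > entry w (-i) then 1 else 0) +
        (if i = -j then (if 0 < (j : ℤ) ∧ entry w (-j) > entry w j then 1 else 0) else 0) := by
      intro i j
      have e : i = -j → entry w i = -entry w j := by rintro rfl; exact entry_neg w j
      simp only [entry_neg, val_neg, abs_lt, Subtype.ext_iff] at e ⊢
      have := i.2.1
      have := j.2.1
      split_ifs <;> omega
    simp only [h1, Finset.sum_add_distrib]
    have h2 : ∑ i : Idx n, ∑ j : Idx n, (if |((-j : Idx n) : ℤ)| < (-i : Idx n) ∧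
        entry w (-j) > entry w (-i) then (1 : ℤ) else 0) =
        ∑ j : Idx n, ∑ i : Idx n, if |(i : ℤ)| < j ∧ entry w i > entry w j then 1 else 0 := by
      rw [sum_neg_idx fun i : Idx n => ∑ j : Idx n, if |((-j : Idx n) : ℤ)| < (i : ℤ) ∧
        entry w (-j) > entry w i then (1 : ℤ) else 0]
      refine Finset.sum_congr rfl fun i _ => ?_
      exact sum_neg_idx fun j : Idx n => if |(j : ℤ)| < (i : ℤ) ∧
        entry w j > entry w i then (1 : ℤ) else 0
    rw [h2, Finset.sum_comm, Finset.sum_comm (f := fun i j : Idx n => if i = -j then _ else _)]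
    simp only [Finset.sum_ite_eq', Finset.mem_univ, if_true]
    ring
  rw [twiceInv, hA, hB] at h
  omega

/-! ### Summation of the probabilities -/

theorem sum_abs_lt (j : Idx n) : ∑ i : Idx n, (if |(i : ℤ)| < j then (1 : ℝ) else 0) =
    if 0 < (j : ℤ) then 2 * ((j : ℤ) : ℝ) - 2 else 0 := by
  have key : ∀ m : ℤ, ∀ N : ℕ, ∑ p ∈ Finset.range N,
      ((if |(p : ℤ) + 1| < m then (1 : ℤ) else 0) + (if |-((p : ℤ) + 1)| < m then 1 else 0)) =
      if 0 < m then (if (N : ℤ) < m then 2 * (N : ℤ) else 2 * m - 2) else 0 := by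
    intro m N
    induction N with
    | zero => simp only [Finset.range_zero, Finset.sum_empty]; split_ifs <;> omega
    | succ N ih =>
      rw [Finset.sum_range_succ, ih, abs_neg, abs_of_pos (by omega)]
      push_cast
      split_ifs <;> omega
  have h := key j n
  rw [← sum_idx fun b : ℤ => if |b| < j then (1 : ℤ) else 0,
    if_neg (not_lt.mpr (abs_le.mp j.2.2).2)] at h
  have h' := congrArg (Int.cast : ℤ → ℝ) h
  push_cast at h'
  exact h'

theorem psi_of_pos {j : Idx n} (hj : 0 < (j : ℤ)) :
    psi j = (((j : ℤ) : ℝ) - 1) / ((n : ℝ) - 1) := by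
  rw [psi, sgn_of_pos hj]

/-- The range `|i| < j` is symmetric, so the odd terms `psi i` cancel and only the number `2 * j -
2` of indices matters. -/
theorem sum_abs_lt_psi (j : Idx n) (α β : ℝ) :
    ∑ i : Idx n, (if |(i : ℤ)| < j then α + β * (psi j - psi i) else 0) =
      if 0 < (j : ℤ) then (2 * ((j : ℤ) : ℝ) - 2) *
        (α + β * ((((j : ℤ) : ℝ) - 1) / ((n : ℝ) - 1))) else 0 := by
  have hodd : ∑ i : Idx n, (if |(i : ℤ)| < j then psi i else 0) = 0 := by
    refine sum_odd_eq_zero fun k => ?_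
    rw [val_neg, abs_neg, psi_neg]
    split_ifs
    · rfl
    · rw [neg_zero]
  have h : ∀ i : Idx n, (if |(i : ℤ)| < j then α + β * (psi j - psi i) else 0) =
      (if |(i : ℤ)| < j then (1 : ℝ) else 0) * (α + β * psi j) -
        β * (if |(i : ℤ)| < j then psi i else 0) := by
    intro i
    split_ifs <;> ring
  simp only [h, Finset.sum_sub_distrib, ← Finset.sum_mul, ← Finset.mul_sum, hodd, sum_abs_lt]
  split_ifs with hj
  · rw [psi_of_pos hj]; ring
  · ring

theorem sum_sum_abs_lt_psi (α β : ℝ) : ∑ j : Idx n, ∑ i : Idx n,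
    (if |(i : ℤ)| < j then α + β * (psi j - psi i) else 0) =
      n * (n - 1) * α + (∑ p ∈ Finset.range n, 2 * (p : ℝ) ^ 2) / ((n : ℝ) - 1) * β := by
  simp only [sum_abs_lt_psi]
  rw [sum_idx fun j : ℤ => if 0 < j then (2 * (j : ℝ) - 2) *
        (α + β * (((j : ℝ) - 1) / ((n : ℝ) - 1))) else 0]
  have h : ∀ p : ℕ, ((if 0 < (p : ℤ) + 1 then (2 * (((p : ℤ) + 1 : ℤ) : ℝ) - 2) *
        (α + β * (((((p : ℤ) + 1 : ℤ) : ℝ) - 1) / ((n : ℝ) - 1))) else 0) +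
      (if 0 < -((p : ℤ) + 1) then (2 * ((-((p : ℤ) + 1) : ℤ) : ℝ) - 2) *
        (α + β * ((((-((p : ℤ) + 1) : ℤ) : ℝ) - 1) / ((n : ℝ) - 1))) else 0)) =
      2 * (p : ℝ) * α + 2 * (p : ℝ) ^ 2 / ((n : ℝ) - 1) * β := by
    intro p
    rw [if_pos (by omega), if_neg (by omega)]
    push_cast
    ring
  have h1 : ∀ N : ℕ, ∑ p ∈ Finset.range N, 2 * (p : ℝ) = N * (N - 1) := by
    intro N
    induction N with
    | zero => simp
    | succ N ih => rw [Finset.sum_range_succ, ih]; push_cast; ring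
  simp only [h, Finset.sum_add_distrib, ← Finset.sum_mul, ← Finset.sum_div, h1]

theorem sum_two_mul_sq (N : ℕ) :
    ∑ p ∈ Finset.range N, 2 * (p : ℝ) ^ 2 = (N : ℝ) * (N - 1) * (2 * N - 1) / 3 := by
  induction N with
  | zero => simp
  | succ N ih => rw [Finset.sum_range_succ, ih]; push_cast; ring

theorem sum_pos_const (c : ℝ) : ∑ i : Idx n, (if 0 < (i : ℤ) then c else 0) = n * c := by
  rw [sum_idx fun i : ℤ => if 0 < i then c else 0, Finset.sum_congr rfl (g := fun _ => c),
    Finset.sum_const, Finset.card_range, nsmul_eq_mul]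
  intro p _
  rw [if_pos (by omega), if_neg (by omega), add_zero]

theorem avg_ite_and {M : Type*} [Monoid M] (R : Finset M) (Q : Prop) [Decidable Q]
    (P : M → Prop) [DecidablePred P] (t : ℕ) :
    avg R t (fun x => if Q ∧ P x then 1 else 0) = if Q then prob R P t else 0 := by
  by_cases h : Q
  · simp only [h, true_and, if_true, prob_eq_avg]
  · simp [h, avg]

theorem expected_length_eq_sum_prob (t : ℕ) :
    expected (reflections n) (coxeterSystem n).length t =
      (∑ i : Idx n, if 0 < (i : ℤ) then
        prob (reflections n) (fun w => entry w (-i) > entry w i) t else 0) +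
      ∑ j : Idx n, ∑ i : Idx n, if |(i : ℤ)| < j then
        prob (reflections n) (fun w => entry w i > entry w j) t else 0 := by
  have h : ∀ w : SignedPerm n, ((coxeterSystem n).length w : ℝ) =
      (∑ i : Idx n, if 0 < (i : ℤ) ∧ entry w (-i) > entry w i then 1 else 0) +
      ∑ j : Idx n, ∑ i : Idx n, if |(i : ℤ)| < j ∧ entry w i > entry w j then 1 else 0 := by
    intro w
    have h := congrArg (Int.cast : ℤ → ℝ) (length_eq_sum w)
    push_cast at h
    exact h
  rw [expected_eq_avg]
  simp only [h]
  rw [avg_add, avg_sum, avg_sum]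
  simp only [avg_sum, avg_ite_and]

theorem expected_length (hn : 1 ≤ n) (t : ℕ) :
    expected (reflections n) (coxeterSystem n).length t =
      (n : ℝ) ^ 2 / 2 - (n : ℝ) * ((n : ℝ) + 1) / 3 * (1 - 2 / (n : ℝ)) ^ t
        - (n : ℝ) * ((n : ℝ) - 2) / 6 * (1 - 4 / (n : ℝ) + 2 / (n : ℝ) ^ 2) ^ t := by
  set q := (1 - 2 / (n : ℝ)) ^ t with hq
  set r := (1 - 4 / (n : ℝ) + 2 / (n : ℝ) ^ 2) ^ t with hr
  have h1 : ∀ i : Idx n, (if 0 < (i : ℤ) then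
      prob (reflections n) (fun w => entry w (-i) > entry w i) t else 0) =
      if 0 < (i : ℤ) then 1 / 2 - 1 / 2 * q else 0 := by
    intro i
    split_ifs with h
    · exact prob_entry_neg_gt hn i (by omega) t
    · rfl
  have h2 : ∀ j i : Idx n, (if |(i : ℤ)| < j then
      prob (reflections n) (fun w => entry w i > entry w j) t else 0) =
      if |(i : ℤ)| < j then (1 - r) / 2 + (r - q) / 2 * (psi j - psi i) else 0 := by
    intro j i
    split_ifs with h
    · rw [prob_entry_gt hn i j h t, ← hq, ← hr]
      ring
    · rfl
  rw [expected_length_eq_sum_prob]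
  simp only [h1, h2]
  rw [sum_pos_const, sum_sum_abs_lt_psi, sum_two_mul_sq]
  -- When `n = 1` there is no denominator to clear, but both bases equal `-1`, so the two powers
  -- merge.
  by_cases hn1 : n = 1
  · have e : r = q := by
      rw [hq, hr, hn1]
      norm_num
    rw [e, hn1]
    push_cast
    ring
  · have : (n : ℝ) - 1 ≠ 0 := sub_ne_zero.mpr (by exact_mod_cast hn1)
    field_simp
    ring

end Hyperoctahedral

theorem mainTheorem2 (n : ℕ) (hn : 1 ≤ n) (t : ℕ) :
    (Hyperoctahedral.expected (Hyperoctahedral.reflections n)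
        (Hyperoctahedral.coxeterSystem n).length t =
      (n : ℝ) ^ 2 / 2 - (n : ℝ) * ((n : ℝ) + 1) / 3 * (1 - 2 / (n : ℝ)) ^ t
        - (n : ℝ) * ((n : ℝ) - 2) / 6 * (1 - 4 / (n : ℝ) + 2 / (n : ℝ) ^ 2) ^ t) ∧
    (∀ i j : Hyperoctahedral.Idx n, |(i : ℤ)| < (j : ℤ) →
      Hyperoctahedral.prob (Hyperoctahedral.reflections n)
          (fun π => Hyperoctahedral.entry π i > Hyperoctahedral.entry π j) t =
        1 / 2
          - (((j : ℤ) : ℝ) - ((i : ℤ) : ℝ) - 1 + (Int.sign (i : ℤ) : ℝ)) / (2 * ((n : ℝ) - 1))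
            * (1 - 2 / (n : ℝ)) ^ t
          + ((((j : ℤ) : ℝ) - ((i : ℤ) : ℝ) - 1 + (Int.sign (i : ℤ) : ℝ)) / (2 * ((n : ℝ) - 1))
              - 1 / 2)
            * (1 - 4 / (n : ℝ) + 2 / (n : ℝ) ^ 2) ^ t) ∧
    (∀ i : Hyperoctahedral.Idx n, 1 ≤ (i : ℤ) →
      Hyperoctahedral.prob (Hyperoctahedral.reflections n)
          (fun π => Hyperoctahedral.entry π (-i) > Hyperoctahedral.entry π i) t =
        1 / 2 - 1 / 2 * (1 - 2 / (n : ℝ)) ^ t) := by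
  refine ⟨Hyperoctahedral.expected_length hn t, fun i j hij => ?_,
    fun i hi => Hyperoctahedral.prob_entry_neg_gt hn i hi t⟩
  -- Here `j > 0` gives `sgn j = 1`, so the numerator is `(j - 1) - (i - sgn i)`.
  have e : (Hyperoctahedral.psi j - Hyperoctahedral.psi i) / 2 =
      (((j : ℤ) : ℝ) - ((i : ℤ) : ℝ) - 1 + (Int.sign (i : ℤ) : ℝ)) / (2 * ((n : ℝ) - 1)) := by
    rw [Hyperoctahedral.psi_of_pos ((abs_nonneg _).trans_lt hij), Hyperoctahedral.psi,
      Hyperoctahedral.sgn, ← sub_div, div_div, mul_comm ((n : ℝ) - 1) 2]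
    congr 1
    ring
  rw [Hyperoctahedral.prob_entry_gt hn i j hij t, e]
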